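/- Let $M$ be a complex manifold and let $C^\infty(M)$ be the algebra of smooth complex-valued functions on $M$. Let $\eta$ be a Poisson tensor on $M$ of type $(1,1)$ (so that $M$ is a Kähler–Poisson manifold): in local holomorphic coordinates $\eta=g^{\bar l k}\,\bar\partial_l\wedge\partial_k$, where $\partial_k=\partial/\partial z^k$ and $\bar\partial_l=\partial/\partial\bar z^l$, and the Poisson bracket is $\{\phi,\psi\}=g^{\bar l k}(\bar\partial_l\phi\,\partial_k\psi-\bar\partial_l\psi\,\partial_k\phi)$. Let $*$ be a star product with separation of variables on $M$, that is, an associative, $\nu$-linear and $\nu$-adically continuous product on $C^\infty(M)[[\nu]]$ with the constant $1$ as unity, given on $f,g\in C^\infty(M)$ by $f*g=\sum_{r\ge 0}\nu^r C_r(f,g)$, where $C_0(f,g)=fg$, $C_1(f,g)-C_1(g,f)=\{f,g\}$, and every $C_r$ is a bidifferential operator that differentiates its first argument only in antiholomorphic directions and its second argument only in holomorphic directions. Then there is a unique formal differential operator $B=\sum_{r\ge 0}\nu^r B_r$ on $M$ (the formal Berezin transform of $*$) such that $B(ab)=b*a$ for every local holomorphic function $a$ and every local antiholomorphic function $b$.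 It can be written as $$B=\exp\Big(\frac1\nu X\Big),$$ where $X=\sum_{r\ge 0}\nu^r X_r$ is a natural formal differential operator (that is, for every $r\ge 0$ the operator $X_r$ is a differential operator of order not greater than $r$) such that $X=0 \pmod{\nu^2}$, that is, $X_0=X_1=0$, and $X_2=\Delta$, where $\Delta$ is the globally defined operator given by $\Delta=g^{\bar l k}\,\partial_k\bar\partial_l$ in local holomorphic coordinates. -/

import Mathlib

open scoped Manifold ContDiff

noncomputable section

namespace KahlerPoisson

/-- The model space `ℂ^d`. -/
abbrev Cn (d : ℕ) : Type := Fin d → ℂ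

/-- Multi-indices. -/
abbrev MIdx (d : ℕ) : Type := Fin d → ℕ

/-! ### Wirtinger derivatives on `ℂ^d` -/

/-- `∂_k = ∂/∂z^k = (∂/∂x^k - i ∂/∂y^k) / 2`. -/
def dz {d : ℕ} (k : Fin d) (F : Cn d → ℂ) (z : Cn d) : ℂ :=
  (fderiv ℝ F z (Pi.single k 1) - Complex.I * fderiv ℝ F z (Pi.single k Complex.I)) / 2

/-- `∂̄_l = ∂/∂z̄^l = (∂/∂x^l + i ∂/∂y^l) / 2`. -/
def dzbar {d : ℕ} (l : Fin d) (F : Cn d → ℂ) (z : Cn d) : ℂ :=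
  (fderiv ℝ F z (Pi.single l 1) + Complex.I * fderiv ℝ F z (Pi.single l Complex.I)) / 2

/-- `∂^α = ∂_1^{α_1} ⋯ ∂_d^{α_d}`. -/
def dzPow {d : ℕ} (α : MIdx d) (F : Cn d → ℂ) : Cn d → ℂ :=
  (List.finRange d).foldr (fun k G => (dz k)^[α k] G) F

/-- `∂̄^β = ∂̄_1^{β_1} ⋯ ∂̄_d^{β_d}`. -/
def dzbarPow {d : ℕ} (β : MIdx d) (F : Cn d → ℂ) : Cn d → ℂ :=
  (List.finRange d).foldr (fun k G => (dzbar k)^[β k] G) F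

/-! ### Smooth functions and (bi)differential operators -/

section Operators

variable (d : ℕ) (M : Type*) [TopologicalSpace M] [ChartedSpace (Cn d) M]

/-- `C^∞(M)`: the algebra of complex-valued functions on `M` that are smooth in the real sense. -/
def Smooth : Subalgebra ℂ (M → ℂ) where
  carrier := {f | ContMDiff 𝓘(ℝ, Cn d) 𝓘(ℝ, ℂ) ∞ f}
  mul_mem' {f g} hf hg := by
    have h : ContDiff ℝ ∞ (fun p : ℂ × ℂ => p.1 * p.2) := contDiff_mul
    exact h.contMDiff.comp (hf.prodMk_space hg)
  add_mem' {f g} hf hg := by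
    have h : ContDiff ℝ ∞ (fun p : ℂ × ℂ => p.1 + p.2) := contDiff_add
    exact h.contMDiff.comp (hf.prodMk_space hg)
  algebraMap_mem' c := (contMDiff_const : ContMDiff 𝓘(ℝ, Cn d) 𝓘(ℝ, ℂ) ∞ fun _ : M => c)

/-- Linear operators on `C^∞(M)`. -/
abbrev Op : Type _ := Module.End ℂ (Smooth d M)

/-- Bilinear operators on `C^∞(M)`. -/
abbrev BiOp : Type _ := Smooth d M →ₗ[ℂ] Smooth d M →ₗ[ℂ] Smooth d M

/-- The holomorphic charts of the complex manifold `M`. -/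
abbrev holCharts : Set (OpenPartialHomeomorph M (Cn d)) :=
  IsManifold.maximalAtlas 𝓘(ℂ, Cn d) ω M

variable {d M}

/-- `∂^α ∂̄^β f` at the point `x`, computed in the chart `e`. -/
def chartDeriv (e : OpenPartialHomeomorph M (Cn d)) (p : MIdx d × MIdx d) (f : M → ℂ) (x : M) : ℂ :=
  dzPow p.1 (dzbarPow p.2 (f ∘ e.symm)) (e x)

/-- Smoothness of a complex-valued function on a subset of `M`. -/
def SmoothOn (c : M → ℂ) (U : Set M) : Prop :=
  ContMDiffOn 𝓘(ℝ, Cn d) 𝓘(ℝ, ℂ) ∞ c U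

/-- `A` is a differential operator: in every holomorphic chart, locally
`A = ∑ c_{αβ} ∂^α ∂̄^β`, a finite sum with smooth coefficients. -/
def IsDiffOp (A : Op d M) : Prop :=
  ∀ e ∈ holCharts d M, ∀ x ∈ e.source, ∃ U ⊆ e.source, IsOpen U ∧ x ∈ U ∧
    ∃ (T : Finset (MIdx d × MIdx d)) (c : MIdx d × MIdx d → M → ℂ),
      (∀ p ∈ T, SmoothOn (d := d) (c p) U) ∧
      ∀ (f : Smooth d M), ∀ y ∈ U, (A f).1 y = ∑ p ∈ T, c p y * chartDeriv e p f.1 y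

/-- `A` is a differential operator of order not greater than `r`. -/
def IsDiffOpOfOrderLE (r : ℕ) (A : Op d M) : Prop :=
  ∀ e ∈ holCharts d M, ∀ x ∈ e.source, ∃ U ⊆ e.source, IsOpen U ∧ x ∈ U ∧
    ∃ (T : Finset (MIdx d × MIdx d)) (c : MIdx d × MIdx d → M → ℂ),
      (∀ p ∈ T, ∑ i, p.1 i + ∑ i, p.2 i ≤ r) ∧
      (∀ p ∈ T, SmoothOn (d := d) (c p) U) ∧
      ∀ (f : Smooth d M), ∀ y ∈ U, (A f).1 y = ∑ p ∈ T, c p y * chartDeriv e p f.1 y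

/-- `C` is a bidifferential operator. -/
def IsBidiffOp (C : BiOp d M) : Prop :=
  ∀ e ∈ holCharts d M, ∀ x ∈ e.source, ∃ U ⊆ e.source, IsOpen U ∧ x ∈ U ∧
    ∃ (T : Finset ((MIdx d × MIdx d) × (MIdx d × MIdx d)))
      (c : (MIdx d × MIdx d) × (MIdx d × MIdx d) → M → ℂ),
      (∀ p ∈ T, SmoothOn (d := d) (c p) U) ∧
      ∀ (f g : Smooth d M), ∀ y ∈ U,
        (C f g).1 y = ∑ p ∈ T, c p y * chartDeriv e p.1 f.1 y * chartDeriv e p.2 g.1 y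

/-- `C` is a bidifferential operator which differentiates its first argument only in
antiholomorphic directions and its second argument only in holomorphic directions:
locally `C(f, g) = ∑ c_{βα} ∂̄^β f ∂^α g`. -/
def SeparatesVariables (C : BiOp d M) : Prop :=
  ∀ e ∈ holCharts d M, ∀ x ∈ e.source, ∃ U ⊆ e.source, IsOpen U ∧ x ∈ U ∧
    ∃ (T : Finset (MIdx d × MIdx d)) (c : MIdx d × MIdx d → M → ℂ),
      (∀ p ∈ T, SmoothOn (d := d) (c p) U) ∧
      ∀ (f g : Smooth d M), ∀ y ∈ U,
        (C f g).1 y = ∑ p ∈ T, c p y * chartDeriv e (0, p.1) f.1 y * chartDeriv e (p.2, 0) g.1 y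

/-- `f` is holomorphic on `U`. -/
def HolOn (f : M → ℂ) (U : Set M) : Prop :=
  MDifferentiableOn 𝓘(ℂ, Cn d) 𝓘(ℂ, ℂ) f U

/-- `f` is antiholomorphic on `U`. -/
def AntiholOn (f : M → ℂ) (U : Set M) : Prop :=
  HolOn (d := d) (fun x => (starRingEnd ℂ) (f x)) U

/-- In the chart `e` the bracket is that of the bivector `g^{l̄ k} ∂̄_l ∧ ∂_k` (with `g l k`
standing for `g^{l̄ k}`): `{φ, ψ} = g^{l̄ k} (∂̄_l φ ∂_k ψ - ∂̄_l ψ ∂_k φ)`. -/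
def IsTensorOn (bracket : BiOp d M) (e : OpenPartialHomeomorph M (Cn d))
    (g : Fin d → Fin d → M → ℂ) : Prop :=
  (∀ l k, SmoothOn (d := d) (g l k) e.source) ∧
  ∀ (φ ψ : Smooth d M), ∀ x ∈ e.source, (bracket φ ψ).1 x = ∑ l, ∑ k, g l k x *
    (dzbar l (φ.1 ∘ e.symm) (e x) * dz k (ψ.1 ∘ e.symm) (e x) -
      dzbar l (ψ.1 ∘ e.symm) (e x) * dz k (φ.1 ∘ e.symm) (e x))

end Operators

/-! ### Kähler-Poisson structures and star products -/

/-- A Kähler-Poisson structure on `M`: a Poisson tensor of type (1,1), given through its Poisson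
bracket. Skew symmetry and the Leibniz rule are contained in the local form. -/
structure Structure (d : ℕ) (M : Type*) [TopologicalSpace M] [ChartedSpace (Cn d) M] where
  bracket : BiOp d M
  exists_tensor : ∀ e ∈ holCharts d M, ∃ g, IsTensorOn bracket e g
  jacobi : ∀ φ ψ χ : Smooth d M,
    bracket φ (bracket ψ χ) + bracket ψ (bracket χ φ) + bracket χ (bracket φ ψ) = 0

section Star

variable {d : ℕ} {M : Type*} [TopologicalSpace M] [ChartedSpace (Cn d) M]

/-- The `ν`-linear, `ν`-adically continuous product on `C^∞(M)[[ν]]` that extends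
`f * g = ∑ ν^r C_r(f, g)`. -/
def formalMul (C : ℕ → BiOp d M) (F G : PowerSeries (Smooth d M)) : PowerSeries (Smooth d M) :=
  PowerSeries.mk fun n => ∑ p ∈ Finset.HasAntidiagonal.antidiagonal n, ∑ q ∈ Finset.HasAntidiagonal.antidiagonal p.2,
    C p.1 (PowerSeries.coeff q.1 F) (PowerSeries.coeff q.2 G)

/-- A star product (formal differentiable deformation quantization) on `(M, {·,·})`, with the
constant 1 as its unity. -/
structure StarProduct (P : Structure d M) where
  C : ℕ → BiOp d M
  bidiff : ∀ r, IsBidiffOp (C r)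
  assoc : ∀ F G H : PowerSeries (Smooth d M),
    formalMul C (formalMul C F G) H = formalMul C F (formalMul C G H)
  one_mul : ∀ F, formalMul C 1 F = F
  mul_one : ∀ F, formalMul C F 1 = F
  C_zero : ∀ f g, C 0 f g = f * g
  C_one : ∀ f g, C 1 f g - C 1 g f = P.bracket f g

/-- The star product is one with separation of variables. -/
def StarProduct.HasSeparation {P : Structure d M} (S : StarProduct P) : Prop :=
  ∀ r, SeparatesVariables (S.C r)

/-- `B = ∑ ν^r B_r` is a formal Berezin transform of the star product: a formal differential
operator such that `B(ab) = b * a` for any local holomorphic `a` and local antiholomorphic `b`.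
As the operators are local, and every local function agrees near a given point with a global
smooth one, it is enough to let `a`, `b` be global smooth functions that are holomorphic,
respectively antiholomorphic, on an open set `U`, and to require the equality on `U`. -/
def StarProduct.IsBerezin {P : Structure d M} (S : StarProduct P)
    (B : PowerSeries (Op d M)) : Prop :=
  (∀ r, IsDiffOp (PowerSeries.coeff r B)) ∧
  ∀ (U : Set M), IsOpen U → ∀ a b : Smooth d M, HolOn (d := d) a.1 U → AntiholOn (d := d) b.1 U →
    ∀ r, ∀ x ∈ U, (PowerSeries.coeff r B (a * b)).1 x = (S.C r b a).1 x

/-- The formal differential operator `A = ∑ ν^r A_r` is natural: `A_r` is of order at most `r`. -/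
def IsNatural (A : PowerSeries (Op d M)) : Prop :=
  ∀ r, IsDiffOpOfOrderLE r (PowerSeries.coeff r A)

/-- `ν⁻¹ X`, for `X` with zero constant term. -/
def divNu (X : PowerSeries (Op d M)) : PowerSeries (Op d M) :=
  PowerSeries.mk fun n => PowerSeries.coeff (n + 1) X

/-- `exp Y = ∑ Y^k / k!`, for `Y` with zero constant term; the terms with `k > n` do not
contribute to the coefficient at `ν^n`. -/
def formalExp (Y : PowerSeries (Op d M)) : PowerSeries (Op d M) :=
  PowerSeries.mk fun n => ∑ k ∈ Finset.range (n + 1),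
    ((Nat.factorial k : ℂ)⁻¹) • PowerSeries.coeff n (Y ^ k)

/-- `D` is the operator `Δ`, given by `g^{l̄ k} ∂_k ∂̄_l` in every holomorphic chart. -/
def Structure.IsDelta (P : Structure d M) (D : Op d M) : Prop :=
  ∀ e ∈ holCharts d M, ∀ g, IsTensorOn P.bracket e g →
    ∀ (f : Smooth d M), ∀ x ∈ e.source, (D f).1 x =
      ∑ l, ∑ k, g l k x * dz k (dzbar l (f.1 ∘ e.symm)) (e x)

end Star

end KahlerPoisson

end

/-!
A differential operator is studied through its full symbol `P(∂, ∂̄)`, at one point and in one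
chart. Exponentials of linear forms in `z` and `z̄` are joint eigenfunctions of the Wirtinger
derivatives, and each of them is a product of a holomorphic and an antiholomorphic function.
Hence a differential operator is determined by its values on products `ab` of a holomorphic `a` and
an antiholomorphic `b` (`IsDiffOp.apply_eq_of_eq_on_products`).

*Existence and uniqueness of `B`.* If `C_r(f, g) = ∑ c_{βα} ∂̄^β f ∂^α g` in a chart, then
`∑ c_{βα} ∂^α ∂̄^β` maps `ab` to `C_r(b, a)`. By the remark above it is the only operator that does,
and the operators of different charts agree on overlaps (`IsBerezinSymbol.value_eq`), because a
change of coordinates carries symbols to symbols (`exists_symb_pullback`). They glue to `B_r`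
(`exists_berezinOp`).

*Naturality.* Since `B_0 = 1`, one has `B = exp Y` with `Y_0 = 0` (`exists_log`), and `X = ν Y`. One
has to show that `Y_r` is of order at most `r + 1`. For a holomorphic function `a` and an
antiholomorphic function `b`, associativity gives `B(a f) = B(f) * a` and `B(b f) = b * B(f)`: by
uniqueness this need only be seen for `f = uv`, with `u` holomorphic and `v` antiholomorphic, where
`B(a u v) = v * (a u) = v * u * a` and similarly for `b`. Therefore `exp (ad Y) a = B a B⁻¹` is the
right multiplication by `a` for the star product. It commutes with the pointwise multiplication by
holomorphic functions, which are not differentiated in the first argument. In the coefficient of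
`ν^r` all terms other than `[Y_r, a]` have order at most `r` by induction, so that for holomorphic
`a`, `a'` the double commutator `[[Y_r, a], a']` has order at most `r - 1`; the same holds for two
antiholomorphic functions. Nothing is known of the mixed double commutators, but among any three
coordinate functions `z^k`, `z̄^l` two are of the same type, and so the triple commutators with
coordinate functions have order at most `r - 2`. This bounds the order of `Y_r` by `r + 1`
(`log_mem_commFilt`, with the order measured by commutators; `StarProduct.IsBerezin.log_orderLE`).

*The leading term.* `Y_1 = B_1`, and `B_1(ab) = C_1(b, a) = C_1(b, a) - C_1(a, b) = {b, a}`, which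
is `Δ(ab)` (`StarProduct.IsBerezin.isDelta_coeff_one`).
-/

open scoped Manifold ContDiff

noncomputable section

namespace KahlerPoisson

/-! ### Wirtinger calculus on `ℂ^d` -/

section Calculus

variable {d : ℕ}

/-- The `2d` coordinate directions of `ℂ^d`: `inl k` for `z^k` and `inr k` for `z̄^k`. -/
abbrev Dir (d : ℕ) : Type := Fin d ⊕ Fin d

/-- The Wirtinger derivative in the coordinate direction `i`, on raw functions. -/
def rawD : Dir d → (Cn d → ℂ) → Cn d → ℂ
  | .inl k => dz k
  | .inr k => dzbar k

theorem mem_smooth_iff {F : Cn d → ℂ} : F ∈ Smooth d (Cn d) ↔ ContDiff ℝ ∞ F :=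
  contMDiff_iff_contDiff

theorem contDiff_val (F : Smooth d (Cn d)) : ContDiff ℝ ∞ F.1 := mem_smooth_iff.1 F.2

theorem differentiable_val (F : Smooth d (Cn d)) : Differentiable ℝ F.1 :=
  (contDiff_val F).differentiable (by simp)

/-- `(∂_v F + c ∂_w F) / 2`, the common form of both kinds of Wirtinger derivatives. -/
def halfD (c : ℂ) (v w : Cn d) (F : Cn d → ℂ) (z : Cn d) : ℂ :=
  (fderiv ℝ F z v + c * fderiv ℝ F z w) / 2

/-- The scalar in the Wirtinger derivative in the direction `i`: `-i` or `i`. -/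
def dirScalar : Dir d → ℂ
  | .inl _ => -Complex.I
  | .inr _ => Complex.I

/-- The index of the variable that the direction `i` belongs to. -/
def dirIndex : Dir d → Fin d
  | .inl k => k
  | .inr k => k

theorem rawD_eq (i : Dir d) (F : Cn d → ℂ) (z : Cn d) :
    rawD i F z = halfD (dirScalar i) (Pi.single (dirIndex i) 1)
      (Pi.single (dirIndex i) Complex.I) F z := by
  cases i <;> simp [rawD, dz, dzbar, halfD, dirScalar, dirIndex, sub_eq_add_neg]

theorem rawD_congr {F G : Cn d → ℂ} {z : Cn d} (h : F =ᶠ[nhds z] G) (i : Dir d) :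
    rawD i F z = rawD i G z := by
  simp only [rawD_eq, halfD, h.fderiv_eq]

theorem rawD_congr_eventually {F G : Cn d → ℂ} {z : Cn d} (h : F =ᶠ[nhds z] G) (i : Dir d) :
    rawD i F =ᶠ[nhds z] rawD i G :=
  h.eventually_nhds.mono fun _ hw => rawD_congr hw i

theorem contDiff_rawD {F : Cn d → ℂ} (hF : ContDiff ℝ ∞ F) (i : Dir d) :
    ContDiff ℝ ∞ (rawD i F) := by
  have h1 : ContDiff ℝ ∞ (fderiv ℝ F) := hF.fderiv_right (by simp)
  have h2 : rawD i F = fun z => (fderiv ℝ F z (Pi.single (dirIndex i) 1) +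
      dirScalar i * fderiv ℝ F z (Pi.single (dirIndex i) Complex.I)) / 2 := by
    funext z; exact rawD_eq i F z
  rw [h2]
  exact ((h1.clm_apply contDiff_const).add
    (contDiff_const.mul (h1.clm_apply contDiff_const))).div_const 2

theorem fderiv_fderiv_comm {F : Cn d → ℂ} (hF : ContDiff ℝ ∞ F) (z v w : Cn d) :
    fderiv ℝ (fun y => fderiv ℝ F y v) z w = fderiv ℝ (fun y => fderiv ℝ F y w) z v := by
  have h1 : DifferentiableAt ℝ (fderiv ℝ F) z :=
    (hF.fderiv_right (m := ∞) (by simp)).differentiable (by simp) z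
  have h2 : ∀ u, fderiv ℝ (fun y => fderiv ℝ F y u) z = (fderiv ℝ (fderiv ℝ F) z).flip u := by
    intro u
    rw [fderiv_clm_apply h1 (differentiableAt_const u)]
    ext; simp
  rw [h2, h2]
  exact (hF.contDiffAt.isSymmSndFDerivAt (by
    rw [minSmoothness_of_isRCLikeNormedField]; exact WithTop.coe_le_coe.2 (le_top : (2 : ℕ∞) ≤ ⊤))).eq _ _

/-- The Wirtinger derivative in the direction `i` as an operator on smooth functions. -/
def D (i : Dir d) : Module.End ℂ (Smooth d (Cn d)) where
  toFun F := ⟨rawD i F.1, mem_smooth_iff.2 (contDiff_rawD (contDiff_val F) i)⟩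
  map_add' F G := by
    ext z
    have h : fderiv ℝ (F.1 + G.1) z = fderiv ℝ F.1 z + fderiv ℝ G.1 z :=
      fderiv_add (differentiable_val F z) (differentiable_val G z)
    simp [rawD_eq, halfD, h]
    ring
  map_smul' c F := by
    ext z
    have h : fderiv ℝ (c • F.1) z = c • fderiv ℝ F.1 z :=
      fderiv_const_smul (differentiable_val F z) c
    simp [rawD_eq, halfD, h]
    ring

theorem D_apply (i : Dir d) (F : Smooth d (Cn d)) (z : Cn d) : (D i F).1 z = rawD i F.1 z := rfl

theorem D_mul (i : Dir d) (F G : Smooth d (Cn d)) : D i (F * G) = D i F * G + F * D i G := by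
  ext z
  have h : fderiv ℝ (F.1 * G.1) z = F.1 z • fderiv ℝ G.1 z + G.1 z • fderiv ℝ F.1 z :=
    fderiv_mul (differentiable_val F z) (differentiable_val G z)
  simp [D_apply, rawD_eq, halfD, h]
  ring

theorem D_comm (i j : Dir d) : D i * D j = D j * D i := by
  ext F z
  have h1 : Differentiable ℝ (fderiv ℝ F.1) :=
    ((contDiff_val F).fderiv_right (m := ∞) (by simp)).differentiable (by simp)
  have key : ∀ (c : ℂ) (v w u : Cn d), fderiv ℝ (halfD c v w F.1) z u =
      (fderiv ℝ (fun y => fderiv ℝ F.1 y v) z u + c * fderiv ℝ (fun y => fderiv ℝ F.1 y w) z u) / 2 := by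
    intro c v w u
    have hv : ∀ v : Cn d, DifferentiableAt ℝ (fun y => fderiv ℝ F.1 y v) z :=
      fun v => (h1 z).clm_apply (differentiableAt_const v)
    have : halfD c v w F.1 = fun y => (2 : ℂ)⁻¹ •
        (fderiv ℝ F.1 y v + c • fderiv ℝ F.1 y w) := by
      funext y; simp [halfD]; ring
    rw [this, fderiv_fun_const_smul (((hv v).fun_add ((hv w).fun_const_smul c))),
      fderiv_fun_add (hv v) ((hv w).fun_const_smul c), fderiv_fun_const_smul (hv w)]
    simp; ring
  have e : ∀ i j : Dir d, (D i (D j F)).1 z = halfD (dirScalar i) (Pi.single (dirIndex i) 1)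
      (Pi.single (dirIndex i) Complex.I) (halfD (dirScalar j) (Pi.single (dirIndex j) 1)
      (Pi.single (dirIndex j) Complex.I) F.1) z := by
    intro i j
    rw [D_apply, rawD_eq]
    congr 1
    funext y
    exact rawD_eq j F.1 y
  change (D i (D j F)).1 z = (D j (D i F)).1 z
  rw [e, e]
  simp only [halfD.eq_1 (dirScalar i) _ _ (halfD _ _ _ _), halfD.eq_1 (dirScalar j) _ _ (halfD _ _ _ _), key]
  have hc := fderiv_fderiv_comm (contDiff_val F) z
  rw [hc (Pi.single (dirIndex j) 1) (Pi.single (dirIndex i) 1),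
    hc (Pi.single (dirIndex j) 1) (Pi.single (dirIndex i) Complex.I),
    hc (Pi.single (dirIndex j) Complex.I) (Pi.single (dirIndex i) 1),
    hc (Pi.single (dirIndex j) Complex.I) (Pi.single (dirIndex i) Complex.I)]
  ring

open scoped IsMulCommutative in
/-- Evaluation of polynomials at a family of pairwise commuting elements of a possibly
noncommutative algebra. -/
def commAeval {σ A : Type*} [Ring A] [Algebra ℂ A] (x : σ → A)
    (hx : ∀ i j, x i * x j = x j * x i) : MvPolynomial σ ℂ →ₐ[ℂ] A :=
  haveI : IsMulCommutative (Algebra.adjoin ℂ (Set.range x)) :=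
    Algebra.isMulCommutative_adjoin ℂ (by rintro _ ⟨i, rfl⟩ _ ⟨j, rfl⟩; exact hx i j)
  (Algebra.adjoin ℂ (Set.range x)).val.comp
    (MvPolynomial.aeval fun i =>
      (⟨x i, Algebra.subset_adjoin ⟨i, rfl⟩⟩ : Algebra.adjoin ℂ (Set.range x)))

open scoped IsMulCommutative in
theorem commAeval_X {σ A : Type*} [Ring A] [Algebra ℂ A] (x : σ → A)
    (hx : ∀ i j, x i * x j = x j * x i) (i : σ) :
    commAeval x hx (MvPolynomial.X i) = x i := by
  simp [commAeval]

/-- The operator `P(∂, ∂̄)` with constant coefficients and full symbol `P`. -/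
def symb : MvPolynomial (Dir d) ℂ →ₐ[ℂ] Module.End ℂ (Smooth d (Cn d)) :=
  commAeval D D_comm

@[simp] theorem symb_X (i : Dir d) : symb (MvPolynomial.X i) = D i := commAeval_X _ _ _

theorem symb_X_mul (i : Dir d) (P : MvPolynomial (Dir d) ℂ) :
    symb (MvPolynomial.X i * P) = D i * symb P := by
  rw [map_mul, symb_X]

theorem symb_mul_comm (P Q : MvPolynomial (Dir d) ℂ) : symb P * symb Q = symb Q * symb P := by
  rw [← map_mul, mul_comm, map_mul]

/-- The exponent in `MvPolynomial (Dir d) ℂ` of a pair of multi-indices. -/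
def dirExp (p : MIdx d × MIdx d) : Dir d →₀ ℕ :=
  Finsupp.equivFunOnFinite.symm (Sum.elim p.1 p.2)

@[simp] theorem dirExp_inl (p : MIdx d × MIdx d) (k : Fin d) : dirExp p (.inl k) = p.1 k := rfl
@[simp] theorem dirExp_inr (p : MIdx d × MIdx d) (k : Fin d) : dirExp p (.inr k) = p.2 k := rfl

theorem dirExp_injective : Function.Injective (dirExp (d := d)) := by
  intro p q h
  ext k
  · exact DFunLike.congr_fun h (.inl k)
  · exact DFunLike.congr_fun h (.inr k)

theorem dirExp_surjective : Function.Surjective (dirExp (d := d)) := by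
  intro m
  refine ⟨(fun k => m (.inl k), fun k => m (.inr k)), ?_⟩
  ext i
  cases i <;> rfl

theorem degree_dirExp (p : MIdx d × MIdx d) :
    (dirExp p).degree = ∑ i, p.1 i + ∑ i, p.2 i := by
  rw [Finsupp.degree_eq_sum, Fintype.sum_sum_type]
  rfl

/-- `∂^α ∂̄^β` as an operator. -/
def pd (p : MIdx d × MIdx d) : Module.End ℂ (Smooth d (Cn d)) :=
  symb (MvPolynomial.monomial (dirExp p) 1)

theorem D_pow_apply (i : Dir d) (n : ℕ) (F : Smooth d (Cn d)) :
    ((D i ^ n) F).1 = (rawD i)^[n] F.1 := by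
  induction n generalizing F with
  | zero => rfl
  | succ n ih => rw [pow_succ, Module.End.mul_apply, ih, Function.iterate_succ_apply]; rfl

theorem list_prod_D_apply (l : List (Fin d)) (s : Fin d → Dir d) (a : MIdx d)
    (F : Smooth d (Cn d)) :
    ((l.map fun k => D (s k) ^ a k).prod F).1 =
      l.foldr (fun k G => (rawD (s k))^[a k] G) F.1 := by
  induction l with
  | nil => rfl
  | cons k l ih => rw [List.map_cons, List.prod_cons, Module.End.mul_apply, D_pow_apply, ih]; rfl

theorem pd_eq (p : MIdx d × MIdx d) :
    pd p = ((List.finRange d).map fun k => D (.inl k) ^ p.1 k).prod *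
      ((List.finRange d).map fun k => D (.inr k) ^ p.2 k).prod := by
  have h : (MvPolynomial.monomial (dirExp p) (1 : ℂ)) =
      ((List.finRange d).map fun k => MvPolynomial.X (.inl k) ^ p.1 k).prod *
      ((List.finRange d).map fun k => MvPolynomial.X (.inr k) ^ p.2 k).prod := by
    rw [MvPolynomial.monomial_eq, Finsupp.prod_fintype _ _ (by simp), Fintype.prod_sum_type,
      ← List.ofFn_eq_map, ← List.ofFn_eq_map, List.prod_ofFn, List.prod_ofFn]
    simp
  rw [pd, h, map_mul, map_list_prod, map_list_prod]
  simp [Function.comp_def]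

theorem pd_apply (p : MIdx d × MIdx d) (F : Smooth d (Cn d)) :
    (pd p F).1 = dzPow p.1 (dzbarPow p.2 F.1) := by
  rw [pd_eq, Module.End.mul_apply, list_prod_D_apply, list_prod_D_apply]
  rfl

theorem pd_split (p : MIdx d × MIdx d) : pd p = pd (p.1, 0) * pd (0, p.2) := by
  simp [pd_eq]

/-! ### Coordinates and exponentials -/

theorem rawD_of_hasFDerivAt {F : Cn d → ℂ} {F' : Cn d →L[ℝ] ℂ} {z : Cn d}
    (h : HasFDerivAt F F' z) (i : Dir d) :
    rawD i F z = (F' (Pi.single (dirIndex i) 1) +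
      dirScalar i * F' (Pi.single (dirIndex i) Complex.I)) / 2 := by
  rw [rawD_eq, halfD, h.fderiv]

/-- The real-linear coordinate function `z^k` or `z̄^k`. -/
def coordL : Dir d → Cn d →L[ℝ] ℂ
  | .inl k => ContinuousLinearMap.proj k
  | .inr k => (Complex.conjCLE : ℂ →L[ℝ] ℂ).comp (ContinuousLinearMap.proj k)

@[simp] theorem coordL_inl (k : Fin d) (z : Cn d) : coordL (.inl k) z = z k := rfl
@[simp] theorem coordL_inr (k : Fin d) (z : Cn d) :
    coordL (.inr k) z = (starRingEnd ℂ) (z k) := rfl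

/-- The coordinate functions as smooth functions. -/
def coord (i : Dir d) : Smooth d (Cn d) :=
  ⟨coordL i, mem_smooth_iff.2 (coordL i).contDiff⟩

theorem coordL_wirtinger (i j : Dir d) : (coordL j (Pi.single (dirIndex i) 1) +
      dirScalar i * coordL j (Pi.single (dirIndex i) Complex.I)) / 2 =
    if i = j then (1 : ℂ) else 0 := by
  rcases i with k | k <;> rcases j with l | l <;> by_cases h : k = l <;>
    simp [dirIndex, dirScalar, h, eq_comm]

theorem D_coord (i j : Dir d) :
    D i (coord j) = if i = j then (1 : Smooth d (Cn d)) else 0 := by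
  ext z
  rw [D_apply]
  refine (rawD_of_hasFDerivAt (coordL j).hasFDerivAt i).trans ?_
  rw [coordL_wirtinger]
  split <;> rfl

/-- The linear form `∑ κ_i z^i` in all the variables `z`, `z̄`. -/
def linForm (κ : Dir d → ℂ) : Cn d →L[ℝ] ℂ := ∑ j, κ j • coordL j

/-- The exponential `exp (∑ κ_i z^i)`, a joint eigenfunction of the Wirtinger derivatives. -/
def expo (κ : Dir d → ℂ) : Smooth d (Cn d) :=
  ⟨fun z => Complex.exp (linForm κ z), mem_smooth_iff.2 (linForm κ).contDiff.cexp⟩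

theorem D_expo (i : Dir d) (κ : Dir d → ℂ) : D i (expo κ) = κ i • expo κ := by
  ext z
  rw [D_apply]
  refine (rawD_of_hasFDerivAt (linForm κ).hasFDerivAt.cexp i).trans ?_
  have h : ∑ j, κ j * ((coordL j (Pi.single (dirIndex i) 1) +
      dirScalar i * coordL j (Pi.single (dirIndex i) Complex.I)) / 2) = κ i := by
    simp [coordL_wirtinger]
  have h2 : (expo κ).1 z = Complex.exp (linForm κ z) := rfl
  change _ = κ i * (expo κ).1 z
  rw [h2]
  conv_rhs => rw [← h]
  simp only [linForm, FunLike.coe_smul, Pi.smul_apply, sum_apply, smul_eq_mul,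
    Finset.mul_sum, Finset.sum_mul, ← Finset.sum_add_distrib, Finset.sum_div]
  exact Finset.sum_congr rfl fun j _ => by ring

theorem expo_ne_zero (κ : Dir d → ℂ) (z : Cn d) : (expo κ).1 z ≠ 0 := Complex.exp_ne_zero _

theorem symb_expo (P : MvPolynomial (Dir d) ℂ) (κ : Dir d → ℂ) :
    symb P (expo κ) = MvPolynomial.eval κ P • expo κ := by
  induction P using MvPolynomial.induction_on with
  | C a =>
    rw [← MvPolynomial.algebraMap_eq, AlgHom.commutes, MvPolynomial.algebraMap_eq,
      MvPolynomial.eval_C]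
    rfl
  | add P Q hP hQ => rw [map_add, LinearMap.add_apply, hP, hQ, map_add, add_smul]
  | mul_X P i hP =>
    rw [mul_comm, symb_X_mul, Module.End.mul_apply, hP, map_smul, D_expo, smul_smul, map_mul,
      MvPolynomial.eval_X, mul_comm]

/-- An operator with constant coefficients is determined by its action on exponentials, at any
single point. -/
theorem symb_ext {P Q : MvPolynomial (Dir d) ℂ} (z : Cn d)
    (h : ∀ κ, (symb P (expo κ)).1 z = (symb Q (expo κ)).1 z) : P = Q := by
  refine MvPolynomial.funext fun κ => ?_
  have := h κ
  rw [symb_expo, symb_expo] at this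
  exact mul_right_cancel₀ (expo_ne_zero κ z) this

theorem symb_coord_mul (P : MvPolynomial (Dir d) ℂ) (i : Dir d) (F : Smooth d (Cn d)) :
    symb P (coord i * F) = coord i * symb P F + symb (MvPolynomial.pderiv i P) F := by
  classical
  induction P using MvPolynomial.induction_on with
  | C a =>
    rw [MvPolynomial.pderiv_C, map_zero, ← MvPolynomial.algebraMap_eq, AlgHom.commutes]
    simp [Module.algebraMap_end_apply]
  | add P Q hP hQ =>
    simp only [map_add, LinearMap.add_apply, hP, hQ]
    ring
  | mul_X P j hP =>
    rw [mul_comm, symb_X_mul, Module.End.mul_apply, hP, map_add, D_mul, D_coord,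
      MvPolynomial.pderiv_mul, MvPolynomial.pderiv_X, map_add, symb_X_mul,
      LinearMap.add_apply, Module.End.mul_apply, Module.End.mul_apply]
    by_cases h : i = j
    · subst h
      simp only [Pi.single_eq_same, if_true, one_mul]
      ring
    · have h' : ¬ j = i := fun e => h e.symm
      simp [h']

end Calculus

/-! ### Differential operators on `ℂ^d` with variable coefficients -/

section VarCoeff

variable {d : ℕ}

/-- Differential operators on `ℂ^d`: combinations of the `P(∂, ∂̄)` with smooth coefficients. -/
def DOp (d : ℕ) : Submodule (Smooth d (Cn d)) (Module.End ℂ (Smooth d (Cn d))) :=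
  Submodule.span _ (Set.range symb)

theorem symb_mem_DOp (P : MvPolynomial (Dir d) ℂ) : symb P ∈ DOp d :=
  Submodule.subset_span ⟨P, rfl⟩

theorem one_mem_DOp : (1 : Module.End ℂ (Smooth d (Cn d))) ∈ DOp d := by
  simpa using symb_mem_DOp (1 : MvPolynomial (Dir d) ℂ)

theorem smul_apply_fun (c : Smooth d (Cn d)) (A : Module.End ℂ (Smooth d (Cn d)))
    (F : Smooth d (Cn d)) : (c • A) F = c * A F := rfl

theorem D_mul_mem_DOp (i : Dir d) {A : Module.End ℂ (Smooth d (Cn d))} (hA : A ∈ DOp d) :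
    D i * A ∈ DOp d := by
  induction hA using Submodule.span_induction with
  | mem A h =>
    obtain ⟨P, rfl⟩ := h
    rw [← symb_X_mul]
    exact symb_mem_DOp _
  | zero => simp
  | add A B _ _ hA hB => rw [mul_add]; exact add_mem hA hB
  | smul c A hA' hA =>
    have h : D i * (c • A) = D i c • A + c • (D i * A) := by
      ext1 F
      simp only [Module.End.mul_apply, smul_apply_fun, LinearMap.add_apply, D_mul]
    rw [h]
    exact add_mem (Submodule.smul_mem _ _ hA') (Submodule.smul_mem _ _ hA)

theorem symb_mul_mem_DOp (P : MvPolynomial (Dir d) ℂ) {A : Module.End ℂ (Smooth d (Cn d))}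
    (hA : A ∈ DOp d) : symb P * A ∈ DOp d := by
  induction P using MvPolynomial.induction_on with
  | C a =>
    have h : symb (MvPolynomial.C a) * A = algebraMap ℂ (Smooth d (Cn d)) a • A := by
      ext1 F
      rw [← MvPolynomial.algebraMap_eq, AlgHom.commutes, Module.End.mul_apply,
        Module.algebraMap_end_apply, smul_apply_fun, Algebra.smul_def]
    rw [h]
    exact Submodule.smul_mem _ _ hA
  | add P Q hP hQ => rw [map_add, add_mul]; exact add_mem hP hQ
  | mul_X P i hP => rw [mul_comm, symb_X_mul, mul_assoc]; exact D_mul_mem_DOp i hP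

theorem mul_mem_DOp {A B : Module.End ℂ (Smooth d (Cn d))} (hA : A ∈ DOp d) (hB : B ∈ DOp d) :
    A * B ∈ DOp d := by
  induction hA using Submodule.span_induction with
  | mem A h =>
    obtain ⟨P, rfl⟩ := h
    exact symb_mul_mem_DOp P hB
  | zero => simp
  | add A A' _ _ hA hA' => rw [add_mul]; exact add_mem hA hA'
  | smul c A _ hA =>
    have h : (c • A) * B = c • (A * B) := rfl
    rw [h]
    exact Submodule.smul_mem _ _ hA

/-- Every differential operator has a full symbol at each point. -/
theorem exists_symb_of_mem_DOp {A : Module.End ℂ (Smooth d (Cn d))} (hA : A ∈ DOp d) (z : Cn d) :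
    ∃ P : MvPolynomial (Dir d) ℂ, ∀ F, (A F).1 z = (symb P F).1 z := by
  induction hA using Submodule.span_induction with
  | mem A h =>
    obtain ⟨P, rfl⟩ := h
    exact ⟨P, fun _ => rfl⟩
  | zero => exact ⟨0, fun F => by rw [map_zero]⟩
  | add A B _ _ hA hB =>
    obtain ⟨P, hP⟩ := hA
    obtain ⟨Q, hQ⟩ := hB
    refine ⟨P + Q, fun F => ?_⟩
    rw [map_add, LinearMap.add_apply, LinearMap.add_apply]
    exact congrArg₂ (· + ·) (hP F) (hQ F)
  | smul c A _ hA =>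
    obtain ⟨P, hP⟩ := hA
    refine ⟨c.1 z • P, fun F => ?_⟩
    rw [map_smul]
    exact congrArg (c.1 z * ·) (hP F)

theorem symb_eq_sum_pd (P : MvPolynomial (Dir d) ℂ) (F : Smooth d (Cn d)) :
    symb P F = ∑ m ∈ P.support, P.coeff m • symb (MvPolynomial.monomial m 1) F := by
  conv_lhs => rw [P.as_sum]
  rw [map_sum, LinearMap.sum_apply]
  refine Finset.sum_congr rfl fun m _ => ?_
  have h : MvPolynomial.monomial m (P.coeff m) = P.coeff m • MvPolynomial.monomial m (1 : ℂ) := by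
    rw [MvPolynomial.smul_monomial, smul_eq_mul, mul_one]
  rw [h, map_smul, LinearMap.smul_apply]

theorem DOp_eq_span_pd : DOp d = Submodule.span (Smooth d (Cn d)) (Set.range pd) := by
  refine le_antisymm (Submodule.span_le.2 ?_) (Submodule.span_mono ?_)
  · rintro _ ⟨P, rfl⟩
    have h : symb P = ∑ m ∈ P.support, algebraMap ℂ (Smooth d (Cn d)) (P.coeff m) •
        symb (MvPolynomial.monomial m 1) := by
      ext1 F
      rw [symb_eq_sum_pd, LinearMap.sum_apply]
      refine Finset.sum_congr rfl fun m _ => ?_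
      rw [smul_apply_fun, Algebra.smul_def]
    rw [h]
    refine Submodule.sum_mem _ fun m _ => Submodule.smul_mem _ _ ?_
    obtain ⟨p, rfl⟩ := dirExp_surjective m
    exact Submodule.subset_span ⟨p, rfl⟩
  · rintro _ ⟨p, rfl⟩
    exact ⟨_, rfl⟩

theorem pd_mem_DOp (p : MIdx d × MIdx d) : pd p ∈ DOp d := symb_mem_DOp _

theorem exists_sum_of_mem_DOp {A : Module.End ℂ (Smooth d (Cn d))} (hA : A ∈ DOp d) :
    ∃ (T : Finset (MIdx d × MIdx d)) (c : MIdx d × MIdx d → Smooth d (Cn d)),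
      A = ∑ p ∈ T, c p • pd p := by
  rw [DOp_eq_span_pd, Finsupp.mem_span_range_iff_exists_finsupp] at hA
  obtain ⟨c, hc⟩ := hA
  exact ⟨c.support, c, hc.symm⟩

theorem symb_congr {F G : Smooth d (Cn d)} {z : Cn d} (h : F.1 =ᶠ[nhds z] G.1)
    (P : MvPolynomial (Dir d) ℂ) : (symb P F).1 =ᶠ[nhds z] (symb P G).1 := by
  induction P using MvPolynomial.induction_on with
  | C a =>
    rw [← MvPolynomial.algebraMap_eq, AlgHom.commutes]
    exact h.fun_const_smul a
  | add P Q hP hQ =>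
    rw [map_add]
    exact hP.add hQ
  | mul_X P i hP =>
    rw [mul_comm, symb_X_mul]
    exact rawD_congr_eventually hP i

theorem dzbarPow_congr {F G : Cn d → ℂ} {z : Cn d} (h : F =ᶠ[nhds z] G) (β : MIdx d) :
    dzbarPow β F =ᶠ[nhds z] dzbarPow β G := by
  unfold dzbarPow
  induction List.finRange d with
  | nil => exact h
  | cons k l ih =>
    rw [List.foldr_cons, List.foldr_cons]
    induction β k with
    | zero => exact ih
    | succ n ihn =>
      rw [Function.iterate_succ_apply', Function.iterate_succ_apply']
      exact rawD_congr_eventually ihn (.inr k)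

theorem dzPow_congr {F G : Cn d → ℂ} {z : Cn d} (h : F =ᶠ[nhds z] G) (α : MIdx d) :
    dzPow α F =ᶠ[nhds z] dzPow α G := by
  unfold dzPow
  induction List.finRange d with
  | nil => exact h
  | cons k l ih =>
    rw [List.foldr_cons, List.foldr_cons]
    induction α k with
    | zero => exact ih
    | succ n ihn =>
      rw [Function.iterate_succ_apply', Function.iterate_succ_apply']
      exact rawD_congr_eventually ihn (.inl k)

/-! ### Products of antiholomorphic and holomorphic functions -/

theorem list_prod_D_mul {s : Fin d → Dir d} {F G : Smooth d (Cn d)} {z : Cn d}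
    (hG : ∀ k, (D (s k) G).1 =ᶠ[nhds z] 0) (l : List (Fin d)) (a : MIdx d) :
    (((l.map fun k => D (s k) ^ a k).prod) (F * G)).1 =ᶠ[nhds z]
      (((l.map fun k => D (s k) ^ a k).prod) F * G).1 := by
  have step : ∀ (k : Fin d) (H K : Smooth d (Cn d)), H.1 =ᶠ[nhds z] (K * G).1 →
      (D (s k) H).1 =ᶠ[nhds z] (D (s k) K * G).1 := by
    intro k H K h
    refine (rawD_congr_eventually h (s k)).trans ?_
    have h1 : rawD (s k) (K * G).1 = (D (s k) K * G + K * D (s k) G).1 := by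
      rw [← D_mul]; rfl
    rw [h1]
    filter_upwards [hG k] with w hw
    change (D (s k) K * G).1 w + K.1 w * (D (s k) G).1 w = _
    rw [hw]
    simp
  induction l with
  | nil => exact Filter.EventuallyEq.rfl
  | cons k l ih =>
    simp only [List.map_cons, List.prod_cons, Module.End.mul_apply]
    induction a k with
    | zero => exact ih
    | succ n ihn =>
      simp only [pow_succ', Module.End.mul_apply]
      exact step k _ _ ihn

theorem pd_inr_mul_of_hol {F G : Smooth d (Cn d)} {z : Cn d}
    (hG : ∀ k, (D (.inr k) G).1 =ᶠ[nhds z] 0) (β : MIdx d) :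
    (pd (0, β) (F * G)).1 =ᶠ[nhds z] (pd (0, β) F * G).1 := by
  have h : pd ((0 : MIdx d), β) = ((List.finRange d).map fun k => D (.inr k) ^ β k).prod := by
    simp [pd_eq]
  rw [h]
  exact list_prod_D_mul hG _ _

theorem pd_inl_mul_of_antihol {F G : Smooth d (Cn d)} {z : Cn d}
    (hG : ∀ k, (D (.inl k) G).1 =ᶠ[nhds z] 0) (α : MIdx d) :
    (pd (α, 0) (F * G)).1 =ᶠ[nhds z] (pd (α, 0) F * G).1 := by
  have h : pd (α, (0 : MIdx d)) = ((List.finRange d).map fun k => D (.inl k) ^ α k).prod := by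
    simp [pd_eq]
  rw [h]
  exact list_prod_D_mul hG _ _

/-- If `F` is holomorphic and `G` is antiholomorphic near `z`, then
`∂^α ∂̄^β (F G) = ∂^α F ∂̄^β G` near `z`. -/
theorem pd_mul_of_hol_of_antihol {F G : Smooth d (Cn d)} {z : Cn d}
    (hF : ∀ k, (D (.inr k) F).1 =ᶠ[nhds z] 0) (hG : ∀ k, (D (.inl k) G).1 =ᶠ[nhds z] 0)
    (p : MIdx d × MIdx d) :
    (pd p (F * G)).1 =ᶠ[nhds z] (pd (p.1, 0) F * pd (0, p.2) G).1 := by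
  rw [pd_split, Module.End.mul_apply, mul_comm F G]
  refine (symb_congr (pd_inr_mul_of_hol hF _) _).trans ?_
  rw [mul_comm]
  refine pd_inl_mul_of_antihol (fun k => ?_) _
  have h2 : D (.inl k) (pd (0, p.2) G) = pd (0, p.2) (D (.inl k) G) := by
    have := symb_mul_comm (MvPolynomial.X (.inl k)) (MvPolynomial.monomial (dirExp (0, p.2)) 1)
    rw [symb_X] at this
    exact LinearMap.congr_fun this G
  rw [h2]
  have h3 := symb_congr (F := D (.inl k) G) (G := 0) (hG k)
    (MvPolynomial.monomial (dirExp (0, p.2)) 1)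
  rw [map_zero] at h3
  exact h3

/-! ### Change of coordinates -/

theorem fderiv_eq_wirtinger (F : Cn d → ℂ) (z v : Cn d) :
    fderiv ℝ F z v = ∑ j : Dir d, coordL j v * rawD j F z := by
  have h1 : v = ∑ k, ((v k).re • (Pi.single k 1 : Cn d) + (v k).im • (Pi.single k Complex.I : Cn d)) := by
    funext l
    rw [Finset.sum_apply]
    simp only [Pi.add_apply, Pi.smul_apply]
    rw [Finset.sum_eq_single l]
    · simp [Complex.re_add_im]
    · intro k _ hk
      simp [Ne.symm hk]
    · simp
  rw [Fintype.sum_sum_type, ← Finset.sum_add_distrib]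
  conv_lhs => rw [h1]
  rw [map_sum]
  refine Finset.sum_congr rfl fun k _ => ?_
  rw [map_add, map_smul, map_smul]
  simp only [rawD, dz, dzbar, coordL_inl, coordL_inr, Complex.real_smul]
  have h2 : v k = (v k).re + (v k).im * Complex.I := (Complex.re_add_im _).symm
  have h3 : (starRingEnd ℂ) (v k) = (v k).re - (v k).im * Complex.I := by
    apply Complex.ext <;> simp
  rw [h3]
  conv_rhs => rw [h2]
  simp only [Complex.add_re, Complex.add_im, Complex.ofReal_re, Complex.ofReal_im, Complex.mul_re,
    Complex.mul_im, Complex.I_re, Complex.I_im]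
  ring_nf
  simp only [Complex.I_sq]
  ring

/-- Pull-back of smooth functions along a smooth map `φ : ℂ^d → ℂ^d`. -/
def pullback (φ : Cn d → Cn d) (hφ : ContDiff ℝ ∞ φ) :
    Smooth d (Cn d) →ₗ[ℂ] Smooth d (Cn d) where
  toFun F := ⟨F.1 ∘ φ, mem_smooth_iff.2 ((contDiff_val F).comp hφ)⟩
  map_add' _ _ := rfl
  map_smul' _ _ := rfl

theorem pullback_apply (φ : Cn d → Cn d) (hφ : ContDiff ℝ ∞ φ) (F : Smooth d (Cn d)) (z : Cn d) :
    (pullback φ hφ F).1 z = F.1 (φ z) := rfl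

/-- The components `φ^k`, `φ̄^k` of a smooth map. -/
def component (φ : Cn d → Cn d) (hφ : ContDiff ℝ ∞ φ) (j : Dir d) : Smooth d (Cn d) :=
  pullback φ hφ (coord j)

theorem D_pullback (φ : Cn d → Cn d) (hφ : ContDiff ℝ ∞ φ) (i : Dir d) (F : Smooth d (Cn d)) :
    D i (pullback φ hφ F) = ∑ j, D i (component φ hφ j) * pullback φ hφ (D j F) := by
  ext z
  have hd : DifferentiableAt ℝ φ z := hφ.differentiable (by simp) z
  have h1 : HasFDerivAt (pullback φ hφ F).1 ((fderiv ℝ F.1 (φ z)).comp (fderiv ℝ φ z)) z :=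
    (differentiable_val F (φ z)).hasFDerivAt.comp z hd.hasFDerivAt
  have h2 : ∀ j, HasFDerivAt (component φ hφ j).1 ((coordL j).comp (fderiv ℝ φ z)) z :=
    fun j => (coordL j).hasFDerivAt.comp z hd.hasFDerivAt
  have h3 : (∑ j, D i (component φ hφ j) * pullback φ hφ (D j F)).1 z =
      ∑ j, (D i (component φ hφ j)).1 z * (D j F).1 (φ z) := by
    rw [AddSubmonoidClass.coe_finsetSum, Finset.sum_apply]
    rfl
  rw [h3, D_apply, rawD_of_hasFDerivAt h1]
  simp only [D_apply, rawD_of_hasFDerivAt (h2 _), ContinuousLinearMap.comp_apply,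
    fderiv_eq_wirtinger F.1, Finset.mul_sum, ← Finset.sum_add_distrib, Finset.sum_div]
  exact Finset.sum_congr rfl fun j _ => by ring

/-- At each point, the operator `F ↦ P(∂, ∂̄) (F ∘ φ)` is given by a full symbol at the image of the
point. For a change of coordinates `φ` this is the transformation of symbols. -/
theorem exists_symb_pullback (φ : Cn d → Cn d) (hφ : ContDiff ℝ ∞ φ)
    (P : MvPolynomial (Dir d) ℂ) (z : Cn d) :
    ∃ Q : MvPolynomial (Dir d) ℂ, ∀ F, (symb P (pullback φ hφ F)).1 z = (symb Q F).1 (φ z) := by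
  -- the operators `F ↦ ∑ c_q · (Q_q(∂, ∂̄) F) ∘ φ` are stable under derivations
  let E : Submodule (Smooth d (Cn d)) (Smooth d (Cn d) →ₗ[ℂ] Smooth d (Cn d)) :=
    Submodule.span _ (Set.range fun Q => pullback φ hφ ∘ₗ symb Q)
  have hD : ∀ i, ∀ A ∈ E, D i ∘ₗ A ∈ E := by
    intro i A hA
    induction hA using Submodule.span_induction with
    | mem A h =>
      obtain ⟨Q, rfl⟩ := h
      have h : D i ∘ₗ (pullback φ hφ ∘ₗ symb Q) = ∑ j, D i (component φ hφ j) •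
          (pullback φ hφ ∘ₗ symb (MvPolynomial.X j * Q)) := by
        ext1 F
        rw [LinearMap.comp_apply, LinearMap.comp_apply, D_pullback, LinearMap.sum_apply]
        refine Finset.sum_congr rfl fun j _ => ?_
        rw [symb_X_mul]
        rfl
      rw [h]
      exact Submodule.sum_mem _ fun j _ => Submodule.smul_mem _ _ (Submodule.subset_span ⟨_, rfl⟩)
    | zero => simp
    | add A B _ _ hA hB => rw [LinearMap.comp_add]; exact add_mem hA hB
    | smul c A hA' hA =>
      have h : D i ∘ₗ (c • A) = D i c • A + c • (D i ∘ₗ A) := by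
        ext1 F
        exact D_mul i c (A F)
      rw [h]
      exact add_mem (Submodule.smul_mem _ _ hA') (Submodule.smul_mem _ _ hA)
  have hP : symb P ∘ₗ pullback φ hφ ∈ E := by
    induction P using MvPolynomial.induction_on with
    | C a =>
      have h : symb (MvPolynomial.C a) ∘ₗ pullback φ hφ =
          pullback φ hφ ∘ₗ symb (MvPolynomial.C a) := by
        rw [← MvPolynomial.algebraMap_eq, AlgHom.commutes]
        rfl
      rw [h]
      exact Submodule.subset_span ⟨_, rfl⟩
    | add P Q hP hQ => rw [map_add, LinearMap.add_comp]; exact add_mem hP hQ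
    | mul_X P i hP => rw [mul_comm, symb_X_mul]; exact hD i _ hP
  suffices h : ∀ A ∈ E, ∃ Q, ∀ F, (A F).1 z = (symb Q F).1 (φ z) from h _ hP
  intro A hA
  induction hA using Submodule.span_induction with
  | mem A h =>
    obtain ⟨Q, rfl⟩ := h
    exact ⟨Q, fun _ => rfl⟩
  | zero => exact ⟨0, fun F => by rw [map_zero]; rfl⟩
  | add A B _ _ hA hB =>
    obtain ⟨P, hP⟩ := hA
    obtain ⟨Q, hQ⟩ := hB
    refine ⟨P + Q, fun F => ?_⟩
    rw [map_add, LinearMap.add_apply, LinearMap.add_apply]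
    exact congrArg₂ (· + ·) (hP F) (hQ F)
  | smul c A _ hA =>
    obtain ⟨P, hP⟩ := hA
    refine ⟨c.1 z • P, fun F => ?_⟩
    rw [map_smul]
    exact congrArg (c.1 z * ·) (hP F)

end VarCoeff

/-! ### Formal exponentials in an algebra -/

section PowerSeriesRing

variable {R : Type*} [Ring R]

theorem coeff_mul_congr {A A' B B' : PowerSeries R} {n : ℕ}
    (hA : ∀ m ≤ n, PowerSeries.coeff m A = PowerSeries.coeff m A')
    (hB : ∀ m ≤ n, PowerSeries.coeff m B = PowerSeries.coeff m B') :
    PowerSeries.coeff n (A * B) = PowerSeries.coeff n (A' * B') := by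
  rw [PowerSeries.coeff_mul, PowerSeries.coeff_mul]
  refine Finset.sum_congr rfl fun p hp => ?_
  have := Finset.HasAntidiagonal.mem_antidiagonal.1 hp
  rw [hA _ (by omega), hB _ (by omega)]

/-- If `A` and `A'` agree below `ν^n` and have no constant term, then `A^k` and `A'^k`
agree up to `ν^n`, for `k ≠ 1`. -/
theorem coeff_pow_congr {A A' : PowerSeries R} {n : ℕ}
    (h0 : PowerSeries.coeff 0 A = 0) (h0' : PowerSeries.coeff 0 A' = 0)
    (h : ∀ m < n, PowerSeries.coeff m A = PowerSeries.coeff m A') (k : ℕ) :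
    (∀ m < n, PowerSeries.coeff m (A ^ k) = PowerSeries.coeff m (A' ^ k)) ∧
    (k ≠ 1 → PowerSeries.coeff n (A ^ k) = PowerSeries.coeff n (A' ^ k)) := by
  induction k with
  | zero => simp
  | succ k ih =>
    have h1 : ∀ m < n, PowerSeries.coeff m (A ^ (k + 1)) = PowerSeries.coeff m (A' ^ (k + 1)) := by
      intro m hm
      rw [pow_succ, pow_succ]
      exact coeff_mul_congr (fun l hl => ih.1 l (by omega)) (fun l hl => h l (by omega))
    refine ⟨h1, fun hk => ?_⟩
    have hk0 : k ≠ 0 := by omega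
    have hz : ∀ B : PowerSeries R, PowerSeries.coeff 0 B = 0 → PowerSeries.coeff 0 (B ^ k) = 0 := by
      intro B hB
      rw [PowerSeries.coeff_zero_eq_constantCoeff_apply] at hB ⊢
      rw [map_pow, hB, zero_pow hk0]
    rw [pow_succ, pow_succ, PowerSeries.coeff_mul, PowerSeries.coeff_mul]
    refine Finset.sum_congr rfl fun p hp => ?_
    have hp' := Finset.HasAntidiagonal.mem_antidiagonal.1 hp
    rcases Nat.eq_zero_or_pos p.1 with h1 | h1
    · rw [h1, hz A h0, hz A' h0', zero_mul, zero_mul]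
    · rcases Nat.eq_zero_or_pos p.2 with h2 | h2
      · rw [h2, h0, h0', mul_zero, mul_zero]
      · rw [ih.1 _ (by omega), h _ (by omega)]

theorem coeff_pow_of_lt {Y : PowerSeries R} (h0 : PowerSeries.coeff 0 Y = 0) {k n : ℕ}
    (h : n < k) : PowerSeries.coeff n (Y ^ k) = 0 := by
  induction k generalizing n with
  | zero => omega
  | succ k ih =>
    rw [pow_succ, PowerSeries.coeff_mul]
    refine Finset.sum_eq_zero fun p hp => ?_
    have hp' := Finset.HasAntidiagonal.mem_antidiagonal.1 hp
    rcases Nat.eq_zero_or_pos p.2 with h2 | h2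
    · rw [h2, h0, mul_zero]
    · rw [ih (by omega), zero_mul]

/-- The iterated commutators `(ad Y)^k a`. -/
def adPow (Y a : PowerSeries R) : ℕ → PowerSeries R
  | 0 => a
  | k + 1 => Y * adPow Y a k - adPow Y a k * Y

theorem coeff_adPow_of_lt {Y : PowerSeries R} (h0 : PowerSeries.coeff 0 Y = 0) (a : PowerSeries R)
    {k n : ℕ} (h : n < k) : PowerSeries.coeff n (adPow Y a k) = 0 := by
  induction k generalizing n with
  | zero => omega
  | succ k ih =>
    rw [adPow, map_sub, PowerSeries.coeff_mul, PowerSeries.coeff_mul,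
      Finset.sum_eq_zero, Finset.sum_eq_zero, sub_zero]
    · intro p hp
      have hp' := Finset.HasAntidiagonal.mem_antidiagonal.1 hp
      rcases Nat.eq_zero_or_pos p.2 with h2 | h2
      · rw [h2, h0, mul_zero]
      · rw [ih (by omega), zero_mul]
    · intro p hp
      have hp' := Finset.HasAntidiagonal.mem_antidiagonal.1 hp
      rcases Nat.eq_zero_or_pos p.1 with h2 | h2
      · rw [h2, h0, zero_mul]
      · rw [ih (by omega), mul_zero]

end PowerSeriesRing

section FormalExp

variable {R : Type*} [Ring R] [Algebra ℂ R]

/-- The coefficient of `ν^n` of `exp Y = ∑ Y^k / k!`, for `Y` with zero constant term. -/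
def expCoeff (Y : PowerSeries R) (n : ℕ) : R :=
  ∑ k ∈ Finset.range (n + 1), ((Nat.factorial k : ℂ)⁻¹) • PowerSeries.coeff n (Y ^ k)

theorem expCoeff_congr {A A' : PowerSeries R} {n : ℕ} (hn : n ≠ 0)
    (h0 : PowerSeries.coeff 0 A = 0) (h0' : PowerSeries.coeff 0 A' = 0)
    (h : ∀ m < n, PowerSeries.coeff m A = PowerSeries.coeff m A') :
    expCoeff A n - PowerSeries.coeff n A = expCoeff A' n - PowerSeries.coeff n A' := by
  have key : ∀ B : PowerSeries R, expCoeff B n - PowerSeries.coeff n B =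
      ∑ k ∈ (Finset.range (n + 1)).erase 1,
        ((Nat.factorial k : ℂ)⁻¹) • PowerSeries.coeff n (B ^ k) := by
    intro B
    rw [expCoeff, ← Finset.add_sum_erase _ _ (Finset.mem_range.2 (by omega : 1 < n + 1))]
    simp
  rw [key, key]
  refine Finset.sum_congr rfl fun k hk => ?_
  rw [(coeff_pow_congr h0 h0' h k).2 (Finset.ne_of_mem_erase hk)]

/-- The coefficients of the formal logarithm of `B`: the coefficient of `ν^n` is what the
coefficients below it leave to be added. -/
def logCoeff (B : PowerSeries R) (n : ℕ) : R :=
  if n = 0 then 0 else PowerSeries.coeff n B -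
    expCoeff (PowerSeries.mk fun m => if _h : m < n then logCoeff B m else 0) n

theorem exists_log {B : PowerSeries R} (hB : PowerSeries.coeff 0 B = 1) :
    ∃ Y : PowerSeries R, PowerSeries.coeff 0 Y = 0 ∧ ∀ n, PowerSeries.coeff n B = expCoeff Y n := by
  have hl0 : logCoeff B 0 = 0 := by rw [logCoeff]; simp
  refine ⟨PowerSeries.mk (logCoeff B), by simp [hl0], fun n => ?_⟩
  rcases Nat.eq_zero_or_pos n with rfl | hn
  · simp [expCoeff, hB]
  · have h := expCoeff_congr (n := n) (A := PowerSeries.mk (logCoeff B))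
      (A' := PowerSeries.mk fun m => if _h : m < n then logCoeff B m else 0) hn.ne'
      (by simp [hl0]) (by simp [hl0]) (fun m hm => by simp [hm])
    simp only [PowerSeries.coeff_mk, lt_self_iff_false, dite_false, sub_zero] at h
    have h2 : logCoeff B n = PowerSeries.coeff n B -
        expCoeff (PowerSeries.mk fun m => if _h : m < n then logCoeff B m else 0) n := by
      conv_lhs => rw [logCoeff]
      rw [if_neg hn.ne']
    rw [← h] at h2
    have h3 : PowerSeries.coeff n B - expCoeff (PowerSeries.mk (logCoeff B)) n = 0 := by
      have : logCoeff B n = PowerSeries.coeff n B -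
        expCoeff (PowerSeries.mk (logCoeff B)) n + logCoeff B n := by
        rw [sub_add]; exact h2
      simpa using this
    exact sub_eq_zero.1 h3

theorem expCoeff_one {Y : PowerSeries R} : expCoeff Y 1 = PowerSeries.coeff 1 Y := by
  simp [expCoeff, Finset.sum_range_succ, PowerSeries.coeff_one]

/-- The coefficient of `ν^n` of `exp (ad Y) a`. -/
def expAdCoeff (Y a : PowerSeries R) (n : ℕ) : R :=
  ∑ k ∈ Finset.range (n + 1), ((Nat.factorial k : ℂ)⁻¹) • PowerSeries.coeff n (adPow Y a k)

/-- `Y^n a = ∑ (n choose k) (ad Y)^k a Y^{n-k}`, with the factorials distributed. -/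
theorem pow_mul_eq_sum_adPow (Y a : PowerSeries R) (n : ℕ) :
    ((Nat.factorial n : ℂ)⁻¹) • (Y ^ n * a) = ∑ p ∈ Finset.HasAntidiagonal.antidiagonal n,
      (((Nat.factorial p.1 : ℂ)⁻¹) • adPow Y a p.1) * (((Nat.factorial p.2 : ℂ)⁻¹) • Y ^ p.2) := by
  let Lm : Module.End ℂ (PowerSeries R) := LinearMap.mulLeft ℂ Y
  let Rm : Module.End ℂ (PowerSeries R) := LinearMap.mulRight ℂ Y
  have hc : Commute (Lm - Rm) Rm :=
    ((LinearMap.commute_mulLeft_right (R := ℂ) Y Y).sub_left (Commute.refl _))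
  have hR : ∀ k, ∀ b, (Rm ^ k) b = b * Y ^ k := by
    intro k b
    rw [LinearMap.pow_mulRight, LinearMap.mulRight_apply]
  have hA : ∀ k, ((Lm - Rm) ^ k) a = adPow Y a k := by
    intro k
    induction k with
    | zero => rfl
    | succ k ih => rw [pow_succ', Module.End.mul_apply, ih]; rfl
  have h1 : Y ^ n * a = (((Lm - Rm) + Rm) ^ n) a := by
    rw [sub_add_cancel, LinearMap.pow_mulLeft, LinearMap.mulLeft_apply]
  have h2 : ∀ p ∈ Finset.HasAntidiagonal.antidiagonal n, ((n.choose p.1 • ((Lm - Rm) ^ p.1 * Rm ^ p.2)) a) =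
      (Nat.factorial n : ℂ) • (((Nat.factorial p.1 : ℂ)⁻¹) • adPow Y a p.1) *
        (((Nat.factorial p.2 : ℂ)⁻¹) • Y ^ p.2) := by
    intro p hp
    have hp' := Finset.HasAntidiagonal.mem_antidiagonal.1 hp
    have h3 : (Lm - Rm) ^ p.1 * Rm ^ p.2 = Rm ^ p.2 * (Lm - Rm) ^ p.1 :=
      ((hc.pow_left _).pow_right _).eq
    rw [h3, LinearMap.smul_apply, Module.End.mul_apply, hA, hR, smul_smul, smul_mul_smul_comm,
      ← Nat.cast_smul_eq_nsmul ℂ]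
    congr 1
    have h4 := Nat.choose_mul_factorial_mul_factorial (show p.1 ≤ n by omega)
    have h5 : n - p.1 = p.2 := by omega
    rw [h5] at h4
    have h6 : ((n.choose p.1 : ℂ) * (Nat.factorial p.1 : ℂ) * (Nat.factorial p.2 : ℂ)) =
        (Nat.factorial n : ℂ) := by exact_mod_cast h4
    rw [← h6]
    have h7 : (Nat.factorial p.1 : ℂ) ≠ 0 := by exact_mod_cast Nat.factorial_ne_zero _
    have h8 : (Nat.factorial p.2 : ℂ) ≠ 0 := by exact_mod_cast Nat.factorial_ne_zero _
    field_simp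
  have h9 : (Nat.factorial n : ℂ) ≠ 0 := by exact_mod_cast Nat.factorial_ne_zero _
  rw [h1, hc.add_pow', LinearMap.sum_apply, Finset.sum_congr rfl h2, Finset.smul_sum]
  refine Finset.sum_congr rfl fun p _ => ?_
  rw [smul_mul_assoc, smul_smul, inv_mul_cancel₀ h9, one_smul]

/-- `exp Y · a = exp (ad Y) a · exp Y`. -/
theorem exp_mul_eq_expAd_mul {Y : PowerSeries R} (h0 : PowerSeries.coeff 0 Y = 0)
    (a : PowerSeries R) :
    PowerSeries.mk (expCoeff Y) * a = PowerSeries.mk (expAdCoeff Y a) * PowerSeries.mk (expCoeff Y) := by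
  ext n
  let E : ℕ → PowerSeries R := fun k => ((Nat.factorial k : ℂ)⁻¹) • Y ^ k
  let G : ℕ → PowerSeries R := fun k => ((Nat.factorial k : ℂ)⁻¹) • adPow Y a k
  have hE : ∀ m ≤ n, PowerSeries.coeff m (PowerSeries.mk (expCoeff Y)) =
      PowerSeries.coeff m (∑ k ∈ Finset.range (n + 1), E k) := by
    intro m hm
    rw [PowerSeries.coeff_mk, expCoeff, map_sum]
    refine Finset.sum_subset_zero_on_sdiff (Finset.range_mono (by omega)) ?_ fun k _ => ?_
    · intro k hk
      simp only [Finset.mem_sdiff, Finset.mem_range] at hk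
      simp only [E, PowerSeries.coeff_smul, coeff_pow_of_lt h0 (show m < k by omega), smul_zero]
    · simp [E]
  have hG : ∀ m ≤ n, PowerSeries.coeff m (PowerSeries.mk (expAdCoeff Y a)) =
      PowerSeries.coeff m (∑ k ∈ Finset.range (n + 1), G k) := by
    intro m hm
    rw [PowerSeries.coeff_mk, expAdCoeff, map_sum]
    refine Finset.sum_subset_zero_on_sdiff (Finset.range_mono (by omega)) ?_ fun k _ => ?_
    · intro k hk
      simp only [Finset.mem_sdiff, Finset.mem_range] at hk
      simp only [G, PowerSeries.coeff_smul, coeff_adPow_of_lt h0 a (show m < k by omega), smul_zero]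
    · simp [G]
  rw [coeff_mul_congr hE (fun m _ => rfl : ∀ m ≤ n, _ = PowerSeries.coeff m a),
    coeff_mul_congr hG hE, Finset.sum_mul, Finset.sum_mul_sum, ← Finset.sum_product', map_sum,
    map_sum]
  have h1 : ∀ k ∈ Finset.range (n + 1), PowerSeries.coeff n (E k * a) =
      ∑ p ∈ Finset.HasAntidiagonal.antidiagonal k, PowerSeries.coeff n (G p.1 * E p.2) := by
    intro k _
    rw [← map_sum]
    congr 1
    simp only [E, G]
    rw [smul_mul_assoc, pow_mul_eq_sum_adPow]
  rw [Finset.sum_congr rfl h1, Finset.sum_sigma']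
  -- the terms with `i + j > n` do not contribute to the coefficient of `ν^n`
  refine Finset.sum_of_injOn (fun x => x.2) ?_ ?_ ?_ (fun _ _ => rfl)
  · rintro ⟨k, p⟩ hx ⟨l, q⟩ hy hpq
    simp only [Finset.coe_sigma, Set.mem_sigma_iff, Finset.mem_coe, Finset.mem_range,
      Finset.HasAntidiagonal.mem_antidiagonal] at hx hy hpq
    subst hpq
    obtain rfl : k = l := by omega
    rfl
  · rintro ⟨k, p⟩ hx
    simp only [Finset.coe_sigma, Set.mem_sigma_iff, Finset.mem_coe, Finset.mem_range,
      Finset.HasAntidiagonal.mem_antidiagonal, Finset.mem_product] at hx ⊢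
    omega
  · rintro ⟨i, j⟩ hx hne
    simp only [Finset.mem_product, Finset.mem_range] at hx
    have hij : n < i + j := by
      by_contra hcon
      refine hne ⟨⟨i + j, (i, j)⟩, ?_, rfl⟩
      simp
      omega
    rw [PowerSeries.coeff_mul]
    refine Finset.sum_eq_zero fun p hp => ?_
    have hp' := Finset.HasAntidiagonal.mem_antidiagonal.1 hp
    simp only [E, G, PowerSeries.coeff_smul]
    by_cases h2 : p.1 < i
    · rw [coeff_adPow_of_lt h0 a h2, smul_zero, zero_mul]
    · rw [coeff_pow_of_lt h0 (show p.2 < j by omega), smul_zero, mul_zero]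

end FormalExp

/-! ### The commutator filtration -/

section Filtration

variable {R : Type*} [Ring R] [Algebra ℂ R]

/-- The commutator filtration of an algebra modulo `N`, with respect to a family `S`: an element
is in step `n` if its `n`-fold commutators with members of `S` are in `N`. -/
def commFilt (N : Submodule ℂ R) (S : Set R) : ℕ → Submodule ℂ R
  | 0 => N
  | n + 1 =>
    { carrier := {A | ∀ s ∈ S, A * s - s * A ∈ commFilt N S n}
      add_mem' := fun {A B} hA hB s hs => by
        have h : (A + B) * s - s * (A + B) = (A * s - s * A) + (B * s - s * B) := by noncomm_ring
        rw [h]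
        exact add_mem (hA s hs) (hB s hs)
      zero_mem' := fun s _ => by simp
      smul_mem' := fun c A hA s hs => by
        have h : (c • A) * s - s * (c • A) = c • (A * s - s * A) := by
          rw [smul_mul_assoc, mul_smul_comm, smul_sub]
        rw [h]
        exact Submodule.smul_mem _ _ (hA s hs) }

variable {N : Submodule ℂ R} {S : Set R}

theorem commFilt_le_succ (hl : ∀ A, ∀ B ∈ N, A * B ∈ N) (hr : ∀ A, ∀ B ∈ N, B * A ∈ N) (n : ℕ) :
    commFilt N S n ≤ commFilt N S (n + 1) := by
  induction n with
  | zero => exact fun A hA s _ => sub_mem (hr s A hA) (hl s A hA)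
  | succ n ih => exact fun A hA s hs => ih (hA s hs)

theorem commFilt_mono (hl : ∀ A, ∀ B ∈ N, A * B ∈ N) (hr : ∀ A, ∀ B ∈ N, B * A ∈ N) :
    Monotone (commFilt N S) :=
  monotone_nat_of_le_succ (commFilt_le_succ hl hr)

/-- If `S` has a commutative centralizer modulo `N`, then the commutator of operators of orders
at most `m` and `n` is of order at most `m + n - 1`; note that the step `n + 1` of the filtration
corresponds to the order `n`. -/
theorem commutator_mem_commFilt (hl : ∀ A, ∀ B ∈ N, A * B ∈ N) (hr : ∀ A, ∀ B ∈ N, B * A ∈ N)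
    (hcent : ∀ A ∈ commFilt N S 1, ∀ B ∈ commFilt N S 1, A * B - B * A ∈ N) {m n : ℕ} {A B : R}
    (hA : A ∈ commFilt N S (m + 1)) (hB : B ∈ commFilt N S (n + 1)) :
    A * B - B * A ∈ commFilt N S (m + n) := by
  have hN : ∀ k, N ≤ commFilt N S k := fun k => commFilt_mono hl hr (Nat.zero_le k)
  induction hk : m + n generalizing m n A B with
  | zero =>
    obtain ⟨rfl, rfl⟩ : m = 0 ∧ n = 0 := by omega
    exact hcent A hA B hB
  | succ k ih =>
    intro s hs
    have h : (A * B - B * A) * s - s * (A * B - B * A) =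
        ((A * s - s * A) * B - B * (A * s - s * A)) +
        (A * (B * s - s * B) - (B * s - s * B) * A) := by noncomm_ring
    rw [h]
    refine add_mem ?_ ?_
    · rcases m with _ | m
      · exact hN _ (sub_mem (hr _ _ (hA s hs)) (hl _ _ (hA s hs)))
      · exact ih (hA s hs) hB (by omega)
    · rcases n with _ | n
      · exact hN _ (sub_mem (hl _ _ (hB s hs)) (hr _ _ (hB s hs)))
      · exact ih hA (hB s hs) (by omega)

/-- An operator whose double commutators with two members of `S₁`, and with two members of `S₂`,
are in step `r + 1`, is in step `r + 3`, although mixed double commutators are not controlled: of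
any three members of `S₁ ∪ S₂` two lie in the same class, and, as the members commute, the
commutators may be taken with these two first. -/
theorem mem_commFilt_of_double {S₁ S₂ : Set R}
    (hS : ∀ s ∈ S₁ ∪ S₂, ∀ t ∈ S₁ ∪ S₂, s * t = t * s) {r : ℕ} {A : R}
    (h₁ : ∀ s ∈ S₁, ∀ t ∈ S₁, (A * s - s * A) * t - t * (A * s - s * A) ∈
      commFilt N (S₁ ∪ S₂) (r + 1))
    (h₂ : ∀ s ∈ S₂, ∀ t ∈ S₂, (A * s - s * A) * t - t * (A * s - s * A) ∈
      commFilt N (S₁ ∪ S₂) (r + 1)) :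
    A ∈ commFilt N (S₁ ∪ S₂) (r + 3) := by
  have hsw : ∀ s ∈ S₁ ∪ S₂, ∀ t ∈ S₁ ∪ S₂, ∀ B : R,
      (B * s - s * B) * t - t * (B * s - s * B) = (B * t - t * B) * s - s * (B * t - t * B) := by
    intro s hs t ht B
    have e1 : (B * s - s * B) * t - t * (B * s - s * B) =
        B * (s * t) - s * B * t - t * B * s + (t * s) * B := by noncomm_ring
    have e2 : (B * t - t * B) * s - s * (B * t - t * B) =
        B * (t * s) - s * B * t - t * B * s + (s * t) * B := by noncomm_ring
    rw [e1, e2, hS s hs t ht]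
  -- a triple commutator whose first two entries lie in the same class falls under the hypotheses
  have key : ∀ s t u, s ∈ S₁ ∪ S₂ → t ∈ S₁ ∪ S₂ → u ∈ S₁ ∪ S₂ →
      ((s ∈ S₁ ∧ t ∈ S₁) ∨ (s ∈ S₂ ∧ t ∈ S₂)) →
      ((A * s - s * A) * t - t * (A * s - s * A)) * u -
        u * ((A * s - s * A) * t - t * (A * s - s * A)) ∈ commFilt N (S₁ ∪ S₂) r := by
    rintro s t u - - hu (⟨hs, ht⟩ | ⟨hs, ht⟩)
    · exact h₁ s hs t ht u hu
    · exact h₂ s hs t ht u hu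
  intro s hs t ht u hu
  by_cases hst : (s ∈ S₁ ∧ t ∈ S₁) ∨ (s ∈ S₂ ∧ t ∈ S₂)
  · exact key s t u hs ht hu hst
  by_cases htu : (t ∈ S₁ ∧ u ∈ S₁) ∨ (t ∈ S₂ ∧ u ∈ S₂)
  · rw [hsw s hs t ht A, hsw s hs u hu]
    exact key t u s ht hu hs htu
  · have hsu : (s ∈ S₁ ∧ u ∈ S₁) ∨ (s ∈ S₂ ∧ u ∈ S₂) := by
      rcases hs with hs | hs <;> rcases ht with ht | ht <;> rcases hu with hu | hu <;> tauto
    rw [hsw t ht u hu]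
    exact key s u t hs hu ht hsu

/-- The order estimate behind naturality. Suppose that for each `a` in one of the classes `S₁`,
`S₂` one has `exp Y · a = Q · exp Y` modulo `N`, with a series `Q` whose coefficients commute modulo
`N` with the members of the class of `a`. Then the coefficient `Y_r` is of order at most `r + 1`.

Indeed `Q = exp (ad Y) a` modulo `N`. In the coefficient of `ν^r` the only term with `Y_r` is
`[Y_r, a]`, and by induction all other terms are of order at most `r`; taking the commutator with a
further member `t` of the class of `a` kills the sum, so `[[Y_r, a], t]` is of order at most
`r - 1`. -/
theorem log_mem_commFilt (hl : ∀ A, ∀ B ∈ N, A * B ∈ N) (hr : ∀ A, ∀ B ∈ N, B * A ∈ N)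
    {S₁ S₂ : Set R} (hS : ∀ s ∈ S₁ ∪ S₂, ∀ t ∈ S₁ ∪ S₂, s * t = t * s)
    (hcent : ∀ A ∈ commFilt N (S₁ ∪ S₂) 1, ∀ B ∈ commFilt N (S₁ ∪ S₂) 1, A * B - B * A ∈ N)
    {Y : PowerSeries R} (h0 : PowerSeries.coeff 0 Y = 0)
    (hconj : ∀ T, T = S₁ ∨ T = S₂ → ∀ a ∈ T, ∃ Q : PowerSeries R,
      (∀ n, PowerSeries.coeff n (PowerSeries.mk (expCoeff Y) * PowerSeries.C a -
        Q * PowerSeries.mk (expCoeff Y)) ∈ N) ∧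
      ∀ n, ∀ t ∈ T, PowerSeries.coeff n Q * t - t * PowerSeries.coeff n Q ∈ N) (r : ℕ) :
    PowerSeries.coeff r Y ∈ commFilt N (S₁ ∪ S₂) (r + 2) := by
  induction r using Nat.strong_induction_on with
  | _ r ih =>
  rcases r with _ | r
  · rw [h0]; exact zero_mem _
  have hNle : ∀ k, N ≤ commFilt N (S₁ ∪ S₂) k := fun k => commFilt_mono hl hr (Nat.zero_le k)
  -- members of `S₁ ∪ S₂` have order zero
  have hSF : ∀ s ∈ S₁ ∪ S₂, s ∈ commFilt N (S₁ ∪ S₂) 1 := by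
    intro s hs t ht
    rw [hS s hs t ht, sub_self]
    exact zero_mem _
  -- the commutator with `Y_s`, `s ≤ r`, raises the order by at most `s`
  have had : ∀ a ∈ S₁ ∪ S₂, ∀ k n, (n < r + 1 ∨ (n = r + 1 ∧ k ≠ 1)) →
      PowerSeries.coeff n (adPow Y (PowerSeries.C a) k) ∈ commFilt N (S₁ ∪ S₂) (n + 1) := by
    intro a ha k
    induction k with
    | zero =>
      intro n _
      rw [adPow, PowerSeries.coeff_C]
      split
      · next h => subst h; exact hSF a ha
      · exact zero_mem _
    | succ k ihk =>
      intro n hn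
      have hterm : ∀ i j, i + j = n →
          PowerSeries.coeff i Y * PowerSeries.coeff j (adPow Y (PowerSeries.C a) k) -
          PowerSeries.coeff j (adPow Y (PowerSeries.C a) k) * PowerSeries.coeff i Y ∈
            commFilt N (S₁ ∪ S₂) (n + 1) := by
        intro i j hij
        rcases Nat.eq_zero_or_pos i with rfl | hi
        · rw [h0, zero_mul, mul_zero, sub_zero]; exact zero_mem _
        by_cases hir : i < r + 1
        · have h1 := ih i hir
          have h2 := ihk j (Or.inl (by omega))
          have h3 := commutator_mem_commFilt hl hr hcent h1 h2
          rwa [show i + 1 + j = n + 1 by omega] at h3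
        · obtain rfl : j = 0 := by omega
          have hk : 0 < k := by omega
          rw [coeff_adPow_of_lt h0 _ hk, mul_zero, zero_mul, sub_zero]
          exact zero_mem _
      rw [adPow, map_sub, PowerSeries.coeff_mul, PowerSeries.coeff_mul,
        ← Finset.Nat.sum_antidiagonal_swap (n := n)
          (f := fun p => PowerSeries.coeff p.1 (adPow Y (PowerSeries.C a) k) *
            PowerSeries.coeff p.2 Y), ← Finset.sum_sub_distrib]
      exact Submodule.sum_mem _ fun p hp => hterm _ _ (Finset.HasAntidiagonal.mem_antidiagonal.1 hp)
  -- the coefficients of `exp (ad Y) a` commute with the class of `a`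
  have hexp : ∀ T, T = S₁ ∨ T = S₂ → ∀ a ∈ T, ∀ t ∈ T, ∀ n,
      expAdCoeff Y (PowerSeries.C a) n * t - t * expAdCoeff Y (PowerSeries.C a) n ∈ N := by
    intro T hT a ha t ht n
    obtain ⟨Q, hQ, hQt⟩ := hconj T hT a ha
    rw [exp_mul_eq_expAd_mul h0, ← sub_mul] at hQ
    have h1 : ∀ n, PowerSeries.coeff n (PowerSeries.mk (expAdCoeff Y (PowerSeries.C a)) - Q) ∈ N := by
      intro n
      induction n using Nat.strong_induction_on with
      | _ n ihn =>
      have h2 := hQ n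
      rw [PowerSeries.coeff_mul, Finset.Nat.sum_antidiagonal_eq_sum_range_succ_mk,
        Finset.sum_range_succ, Nat.sub_self, PowerSeries.coeff_mk 0,
        show expCoeff Y 0 = 1 by simp [expCoeff], mul_one] at h2
      have h3 : ∑ k ∈ Finset.range n,
          PowerSeries.coeff k (PowerSeries.mk (expAdCoeff Y (PowerSeries.C a)) - Q) *
          PowerSeries.coeff (n - k) (PowerSeries.mk (expCoeff Y)) ∈ N :=
        Submodule.sum_mem _ fun k hk => hr _ _ (ihn k (Finset.mem_range.1 hk))
      exact (Submodule.add_mem_iff_right _ h3).1 h2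
    have h2 := h1 n
    rw [map_sub, PowerSeries.coeff_mk] at h2
    have h3 : expAdCoeff Y (PowerSeries.C a) n * t - t * expAdCoeff Y (PowerSeries.C a) n =
        ((expAdCoeff Y (PowerSeries.C a) n - PowerSeries.coeff n Q) * t -
          t * (expAdCoeff Y (PowerSeries.C a) n - PowerSeries.coeff n Q)) +
        (PowerSeries.coeff n Q * t - t * PowerSeries.coeff n Q) := by noncomm_ring
    rw [h3]
    exact add_mem (sub_mem (hr _ _ h2) (hl _ _ h2)) (hQt n t ht)
  have hdouble : ∀ T, T = S₁ ∨ T = S₂ → T ⊆ S₁ ∪ S₂ → ∀ a ∈ T, ∀ t ∈ T,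
      (PowerSeries.coeff (r + 1) Y * a - a * PowerSeries.coeff (r + 1) Y) * t -
        t * (PowerSeries.coeff (r + 1) Y * a - a * PowerSeries.coeff (r + 1) Y) ∈
      commFilt N (S₁ ∪ S₂) (r + 1) := by
    intro T hT hsub a ha t ht
    have h1 : expAdCoeff Y (PowerSeries.C a) (r + 1) =
        (PowerSeries.coeff (r + 1) Y * a - a * PowerSeries.coeff (r + 1) Y) +
        ∑ k ∈ (Finset.range (r + 1 + 1)).erase 1,
          ((Nat.factorial k : ℂ)⁻¹) • PowerSeries.coeff (r + 1) (adPow Y (PowerSeries.C a) k) := by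
      rw [expAdCoeff, ← Finset.add_sum_erase _ _ (Finset.mem_range.2 (by omega : 1 < r + 1 + 1))]
      simp [adPow]
    have h2 : ∑ k ∈ (Finset.range (r + 1 + 1)).erase 1,
          ((Nat.factorial k : ℂ)⁻¹) • PowerSeries.coeff (r + 1) (adPow Y (PowerSeries.C a) k) ∈
        commFilt N (S₁ ∪ S₂) (r + 1 + 1) :=
      Submodule.sum_mem _ fun k hk => Submodule.smul_mem _ _
        (had a (hsub ha) k (r + 1) (Or.inr ⟨rfl, Finset.ne_of_mem_erase hk⟩))
    have h3 := h2 t (hsub ht)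
    have h4 := hNle (r + 1) (hexp T hT a ha t ht (r + 1))
    have h5 := sub_mem h4 h3
    rw [h1] at h5
    convert h5 using 1
    noncomm_ring
  exact mem_commFilt_of_double hS (hdouble S₁ (Or.inl rfl) Set.subset_union_left)
    (hdouble S₂ (Or.inr rfl) Set.subset_union_right)

end Filtration

/-! ### Holomorphic charts and germs of smooth functions -/

section Germs

variable {d : ℕ} {M : Type*} [TopologicalSpace M]

/-- `F` is, near the point `y`, the expression of `f` in the chart `e`. -/
def Rep (e : OpenPartialHomeomorph M (Cn d)) (y : M) (F : Smooth d (Cn d)) (f : M → ℂ) : Prop :=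
  (fun z => F.1 (e z)) =ᶠ[nhds y] f

variable {e : OpenPartialHomeomorph M (Cn d)} {y : M} {F G : Smooth d (Cn d)} {f g : M → ℂ}

theorem Rep.eventually (h : Rep e y F f) : ∀ᶠ z in nhds y, Rep e z F f :=
  Filter.Eventually.eventually_nhds h

theorem Rep.self_eq (h : Rep e y F f) : f y = F.1 (e y) := (Filter.EventuallyEq.eq_of_nhds h).symm

theorem Rep.add (hF : Rep e y F f) (hG : Rep e y G g) : Rep e y (F + G) (f + g) :=
  Filter.EventuallyEq.add hF hG

theorem Rep.mul (hF : Rep e y F f) (hG : Rep e y G g) : Rep e y (F * G) (f * g) :=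
  Filter.EventuallyEq.mul hF hG

theorem Rep.smul (c : ℂ) (hF : Rep e y F f) : Rep e y (c • F) (c • f) :=
  Filter.EventuallyEq.const_smul hF c

theorem Rep.congr (h : Rep e y F f) (hfg : f =ᶠ[nhds y] g) : Rep e y F g :=
  Filter.EventuallyEq.trans h hfg

theorem Rep.eventuallyEq_symm (hy : y ∈ e.source) (h : Rep e y F f) :
    F.1 =ᶠ[nhds (e y)] f ∘ e.symm := by
  have h1 : Filter.Tendsto e.symm (nhds (e y)) (nhds y) := e.tendsto_symm hy
  filter_upwards [h1.eventually h, e.open_target.mem_nhds (e.map_source hy)] with w hw hwt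
  rw [e.right_inv hwt] at hw
  exact hw

theorem Rep.eventuallyEq (hy : y ∈ e.source) (hF : Rep e y F f) (hG : Rep e y G f) :
    F.1 =ᶠ[nhds (e y)] G.1 :=
  (hF.eventuallyEq_symm hy).trans (hG.eventuallyEq_symm hy).symm

theorem Rep.chartDeriv (hy : y ∈ e.source) (h : Rep e y F f) (p : MIdx d × MIdx d) :
    chartDeriv e p f y = (pd p F).1 (e y) := by
  rw [pd_apply]
  exact (dzPow_congr (dzbarPow_congr (h.eventuallyEq_symm hy).symm _) _).eq_of_nhds

end Germs

section Charts

variable {d : ℕ} {M : Type*} [TopologicalSpace M] [ChartedSpace (Cn d) M]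

theorem mem_realGroupoid {e : OpenPartialHomeomorph (Cn d) (Cn d)}
    (he : e ∈ contDiffGroupoid ω 𝓘(ℂ, Cn d)) : e ∈ contDiffGroupoid ∞ 𝓘(ℝ, Cn d) := by
  rw [contDiffGroupoid, mem_groupoid_of_pregroupoid] at he ⊢
  have h : ∀ (f : Cn d → Cn d) (s : Set (Cn d)),
      (contDiffPregroupoid ω 𝓘(ℂ, Cn d)).property f s →
      (contDiffPregroupoid ∞ 𝓘(ℝ, Cn d)).property f s := by
    intro f s hf
    simp only [contDiffPregroupoid, modelWithCornersSelf_coe, modelWithCornersSelf_coe_symm,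
      Function.id_comp, Function.comp_id, Set.preimage_id, Set.range_id, Set.inter_univ] at hf ⊢
    exact (hf.of_le (by simp)).restrict_scalars ℝ
  exact ⟨h _ _ he.1, h _ _ he.2⟩

/-- The complex manifold, regarded as a real one. -/
instance realIsManifold [IsManifold 𝓘(ℂ, Cn d) ω M] : IsManifold 𝓘(ℝ, Cn d) ∞ M where
  compatible he he' := mem_realGroupoid (HasGroupoid.compatible (G := contDiffGroupoid ω 𝓘(ℂ, Cn d)) he he')

theorem realChart_of_holChart {e : OpenPartialHomeomorph M (Cn d)} (he : e ∈ holCharts d M) :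
    e ∈ IsManifold.maximalAtlas 𝓘(ℝ, Cn d) ∞ M := by
  intro e' he'
  exact ⟨mem_realGroupoid (he e' he').1, mem_realGroupoid (he e' he').2⟩

theorem exists_cutoff [T2Space M] [IsManifold 𝓘(ℝ, Cn d) ∞ M] (c : M) {s : Set M}
    (hs : s ∈ nhds c) : ∃ χ : M → ℂ, ContMDiff 𝓘(ℝ, Cn d) 𝓘(ℝ, ℂ) ∞ χ ∧ χ =ᶠ[nhds c] 1 ∧
      tsupport χ ⊆ s := by
  obtain ⟨b, -, hb⟩ := (SmoothBumpFunction.nhds_basis_tsupport (I := 𝓘(ℝ, Cn d)) c).mem_iff.1 hs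
  refine ⟨fun x => (b x : ℂ), ?_, ?_, ?_⟩
  · have h : ContDiff ℝ ∞ (fun t : ℝ => (t : ℂ)) := Complex.ofRealCLM.contDiff
    exact h.contMDiff.comp b.contMDiff
  · filter_upwards [b.eventuallyEq_one] with x hx
    simp [hx]
  · refine (closure_mono ?_).trans hb
    intro x hx h0
    exact hx (by simp [h0])

theorem cutoff_mul_mem {χ g : M → ℂ} {s : Set M} (hs : IsOpen s)
    (hχ : ContMDiff 𝓘(ℝ, Cn d) 𝓘(ℝ, ℂ) ∞ χ) (hsupp : tsupport χ ⊆ s)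
    (hg : SmoothOn (d := d) g s) : (fun x => χ x * g x) ∈ Smooth d M := by
  change ContMDiff 𝓘(ℝ, Cn d) 𝓘(ℝ, ℂ) ∞ _
  refine contMDiff_of_tsupport fun x hx => ?_
  have hxs : x ∈ s := hsupp (tsupport_mul_subset_left hx)
  have h : ContDiff ℝ ∞ (fun p : ℂ × ℂ => p.1 * p.2) := contDiff_mul
  exact h.contMDiff.contMDiffAt.comp x
    (hχ.contMDiffAt.prodMk_space (hg.contMDiffAt (hs.mem_nhds hxs)))

variable {e : OpenPartialHomeomorph M (Cn d)} {y : M} {F G : Smooth d (Cn d)} {f g : M → ℂ}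

/-- A smooth function near a point of a chart has a global expression on `ℂ^d`. -/
theorem exists_rep (he : e ∈ holCharts d M) {U : Set M} (hU : IsOpen U) (hUe : U ⊆ e.source)
    (hy : y ∈ U) {c : M → ℂ} (hc : SmoothOn (d := d) c U) : ∃ F, Rep e y F c := by
  have hs : IsOpen (e.target ∩ e.symm ⁻¹' U) := e.isOpen_inter_preimage_symm hU
  have hys : e y ∈ e.target ∩ e.symm ⁻¹' U :=
    ⟨e.map_source (hUe hy), by rwa [Set.mem_preimage, e.left_inv (hUe hy)]⟩
  obtain ⟨χ, h1, h2, h3⟩ := exists_cutoff (d := d) (e y) (hs.mem_nhds hys)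
  have hcs : SmoothOn (d := d) (c ∘ e.symm) (e.target ∩ e.symm ⁻¹' U) :=
    ContMDiffOn.comp hc ((contMDiffOn_symm_of_mem_maximalAtlas
      (realChart_of_holChart he)).mono Set.inter_subset_left) Set.inter_subset_right
  refine ⟨⟨_, cutoff_mul_mem hs h1 h3 hcs⟩, ?_⟩
  have h4 : Filter.Tendsto e (nhds y) (nhds (e y)) := e.continuousAt (hUe hy)
  filter_upwards [h4.eventually h2, hU.mem_nhds hy] with z hz hzU
  change χ (e z) * c (e.symm (e z)) = c z
  rw [hz, e.left_inv (hUe hzU)]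
  simp

theorem exists_rep_smooth (he : e ∈ holCharts d M) (hy : y ∈ e.source) (f : Smooth d M) :
    ∃ F, Rep e y F f.1 :=
  exists_rep he e.open_source subset_rfl hy (ContMDiff.contMDiffOn f.2)

/-- Every smooth function on `ℂ^d` is near a given point the expression of a smooth function
on the manifold. -/
theorem exists_smooth_rep [T2Space M] [IsManifold 𝓘(ℂ, Cn d) ω M]
    (he : e ∈ holCharts d M) (hy : y ∈ e.source)
    (F : Smooth d (Cn d)) : ∃ f : Smooth d M, Rep e y F f.1 := by
  obtain ⟨χ, h1, h2, h3⟩ := exists_cutoff (d := d) y (e.open_source.mem_nhds hy)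
  have hF : SmoothOn (d := d) (F.1 ∘ e) e.source :=
    ContMDiff.comp_contMDiffOn F.2 (contMDiffOn_of_mem_maximalAtlas (realChart_of_holChart he))
  refine ⟨⟨_, cutoff_mul_mem e.open_source h1 h3 hF⟩, ?_⟩
  filter_upwards [h2] with z hz
  change F.1 (e z) = χ z * F.1 (e z)
  rw [hz]
  simp

theorem smoothOn_comp_chart (he : e ∈ holCharts d M) (F : Smooth d (Cn d)) :
    SmoothOn (d := d) (fun z => F.1 (e z)) e.source :=
  ContMDiff.comp_contMDiffOn F.2 (contMDiffOn_of_mem_maximalAtlas (realChart_of_holChart he))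

/-! ### Holomorphic and antiholomorphic functions in a chart -/

theorem dzbar_eq_zero_of_differentiableAt {H : Cn d → ℂ} {z : Cn d}
    (h : DifferentiableAt ℂ H z) (k : Fin d) : dzbar k H z = 0 := by
  rw [dzbar, h.fderiv_restrictScalars ℝ]
  have h1 : (Pi.single k Complex.I : Cn d) = Complex.I • Pi.single k 1 := by
    rw [← Pi.single_smul, smul_eq_mul, mul_one]
  rw [h1, ContinuousLinearMap.coe_restrictScalars', map_smul, smul_eq_mul, ← mul_assoc,
    Complex.I_mul_I]
  ring

theorem dz_eq_conj_dzbar {H : Cn d → ℂ} {z : Cn d} (h : DifferentiableAt ℝ H z) (k : Fin d) :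
    dz k H z = (starRingEnd ℂ) (dzbar k (fun w => (starRingEnd ℂ) (H w)) z) := by
  have h1 : HasFDerivAt (fun w => (starRingEnd ℂ) (H w))
      ((Complex.conjCLE : ℂ →L[ℝ] ℂ).comp (fderiv ℝ H z)) z :=
    (Complex.conjCLE : ℂ →L[ℝ] ℂ).hasFDerivAt.comp z h.hasFDerivAt
  rw [dzbar, h1.fderiv, dz]
  simp [sub_eq_add_neg, map_ofNat]

theorem differentiableAt_of_holOn (he : e ∈ holCharts d M) {U : Set M} (hU : IsOpen U)
    (hy : y ∈ e.source) (hyU : y ∈ U) (hf : HolOn (d := d) f U) :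
    ∀ᶠ w in nhds (e y), DifferentiableAt ℂ (f ∘ e.symm) w := by
  have hs : IsOpen (e.target ∩ e.symm ⁻¹' U) := e.isOpen_inter_preimage_symm hU
  have h1 : MDifferentiableOn 𝓘(ℂ, Cn d) 𝓘(ℂ, ℂ) (f ∘ e.symm) (e.target ∩ e.symm ⁻¹' U) :=
    MDifferentiableOn.comp hf (((contMDiffOn_symm_of_mem_maximalAtlas he).mdifferentiableOn
      (by simp)).mono Set.inter_subset_left) Set.inter_subset_right
  rw [mdifferentiableOn_iff_differentiableOn] at h1
  filter_upwards [hs.mem_nhds ⟨e.map_source hy, by rwa [Set.mem_preimage, e.left_inv hy]⟩] with w hw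
  exact (h1 w hw).differentiableAt (hs.mem_nhds hw)

theorem D_inr_eq_zero_of_holOn (he : e ∈ holCharts d M) {U : Set M} (hU : IsOpen U)
    (hy : y ∈ e.source) (hyU : y ∈ U) (hf : HolOn (d := d) f U) (hF : Rep e y F f) (k : Fin d) :
    (D (.inr k) F).1 =ᶠ[nhds (e y)] 0 := by
  refine (rawD_congr_eventually (hF.eventuallyEq_symm hy) (.inr k)).trans ?_
  filter_upwards [differentiableAt_of_holOn he hU hy hyU hf] with w hw
  exact dzbar_eq_zero_of_differentiableAt hw k

theorem D_inl_eq_zero_of_antiholOn (he : e ∈ holCharts d M) {U : Set M} (hU : IsOpen U)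
    (hy : y ∈ e.source) (hyU : y ∈ U) (hf : AntiholOn (d := d) f U) (hF : Rep e y F f)
    (k : Fin d) : (D (.inl k) F).1 =ᶠ[nhds (e y)] 0 := by
  filter_upwards [(hF.eventuallyEq_symm hy).eventually_nhds,
    differentiableAt_of_holOn he hU hy hyU hf] with w hw hd
  change dz k F.1 w = 0
  rw [dz_eq_conj_dzbar (differentiable_val F w) k]
  have h1 : (fun w => (starRingEnd ℂ) (F.1 w)) =ᶠ[nhds w]
      (fun x => (starRingEnd ℂ) (f x)) ∘ e.symm := by
    filter_upwards [hw] with v hv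
    rw [hv]
    rfl
  have h2 : dzbar k (fun w => (starRingEnd ℂ) (F.1 w)) w = 0 :=
    (rawD_congr h1 (.inr k)).trans (dzbar_eq_zero_of_differentiableAt hd k)
  rw [h2, map_zero]

end Charts

/-! ### Differential operators and their symbols in a chart -/

section Operators

variable {d : ℕ} {M : Type*} [TopologicalSpace M] [ChartedSpace (Cn d) M]
  {e : OpenPartialHomeomorph M (Cn d)} {x y : M} {U : Set M}

/-- `P` is the full symbol of `A` at the point `y` in the chart `e`. -/
def HasSymbol (e : OpenPartialHomeomorph M (Cn d)) (y : M) (A : Op d M)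
    (P : MvPolynomial (Dir d) ℂ) : Prop :=
  ∀ (f : Smooth d M) (F : Smooth d (Cn d)), Rep e y F f.1 → (A f).1 y = (symb P F).1 (e y)

/-- The operator `A'` on `ℂ^d` is the expression of `A` in the chart `e` over `U`. -/
def Presents (e : OpenPartialHomeomorph M (Cn d)) (U : Set M) (A : Op d M)
    (A' : Op d (Cn d)) : Prop :=
  ∀ y ∈ U, ∀ (f : Smooth d M) (F : Smooth d (Cn d)), Rep e y F f.1 → Rep e y (A' F) (A f).1

/-- Near `x`, the expression of `A` in the chart `e` is a differential operator on `ℂ^d`. -/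
def LocallyPresented (e : OpenPartialHomeomorph M (Cn d)) (x : M) (A : Op d M) : Prop :=
  ∃ U ⊆ e.source, IsOpen U ∧ x ∈ U ∧ ∃ A' ∈ DOp d, Presents e U A A'

theorem presents_of_pointwise (hU : IsOpen U) {A : Op d M} {A' : Op d (Cn d)}
    (h : ∀ y ∈ U, ∀ (f : Smooth d M) (F : Smooth d (Cn d)), Rep e y F f.1 →
      (A f).1 y = (A' F).1 (e y)) : Presents e U A A' := by
  intro y hy f F hF
  filter_upwards [hF.eventually, hU.mem_nhds hy] with z hz hzU
  exact (h z hzU f F hz).symm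

theorem smoothOn_chartDeriv (he : e ∈ holCharts d M) (p : MIdx d × MIdx d) (f : Smooth d M) :
    SmoothOn (d := d) (chartDeriv e p f.1) e.source := by
  intro y hy
  obtain ⟨F, hF⟩ := exists_rep_smooth he hy f
  have h1 := (smoothOn_comp_chart he (pd p F)).contMDiffAt (e.open_source.mem_nhds hy)
  refine ContMDiffAt.contMDiffWithinAt (h1.congr_of_eventuallyEq ?_)
  filter_upwards [hF.eventually, e.open_source.mem_nhds hy] with z hz hzs
  exact hz.chartDeriv hzs p

theorem smoothOn_mul {a b : M → ℂ} (ha : SmoothOn (d := d) a U) (hb : SmoothOn (d := d) b U) :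
    SmoothOn (d := d) (fun z => a z * b z) U := by
  have h : ContDiff ℝ ∞ (fun p : ℂ × ℂ => p.1 * p.2) := contDiff_mul
  exact h.contMDiff.comp_contMDiffOn (ha.prodMk_space hb)

theorem smoothOn_sum {κ : Type*} (T : Finset κ) {a : κ → M → ℂ}
    (ha : ∀ p ∈ T, SmoothOn (d := d) (a p) U) :
    SmoothOn (d := d) (fun z => ∑ p ∈ T, a p z) U :=
  contMDiffOn_finsetSum ha

theorem sum_apply_smooth {N : Type*} [TopologicalSpace N] [ChartedSpace (Cn d) N] {κ : Type*}
    (T : Finset κ) (a : κ → Smooth d N) (z : N) :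
    (∑ p ∈ T, a p).1 z = ∑ p ∈ T, (a p).1 z := by
  rw [AddSubmonoidClass.coe_finsetSum, Finset.sum_apply]

/-- A local normal form gives an expression on `ℂ^d`, by extension of the coefficients. -/
theorem exists_presents (he : e ∈ holCharts d M) (hU : IsOpen U) (hUe : U ⊆ e.source)
    (hx : x ∈ U) {κ : Type*} (T : Finset κ) (c : κ → M → ℂ) (q : κ → MIdx d × MIdx d)
    (hc : ∀ p ∈ T, SmoothOn (d := d) (c p) U) :
    ∃ (V : Set M) (c' : κ → Smooth d (Cn d)), V ⊆ U ∧ IsOpen V ∧ x ∈ V ∧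
      ∀ A : Op d M, (∀ (f : Smooth d M), ∀ y ∈ U,
        (A f).1 y = ∑ p ∈ T, c p y * chartDeriv e (q p) f.1 y) →
        Presents e V A (∑ p ∈ T, c' p • pd (q p)) := by
  have h1 : ∀ p, ∃ F, p ∈ T → Rep e x F (c p) := by
    intro p
    by_cases hp : p ∈ T
    · obtain ⟨F, hF⟩ := exists_rep he hU hUe hx (hc p hp)
      exact ⟨F, fun _ => hF⟩
    · exact ⟨0, fun h => absurd h hp⟩
  choose c' hc' using h1
  have h2 : ∀ᶠ z in nhds x, ∀ p ∈ T, Rep e z (c' p) (c p) :=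
    (Filter.eventually_all_finset T).2 fun p hp => (hc' p hp).eventually
  obtain ⟨V, hV, hVo, hxV⟩ := eventually_nhds_iff.1 (h2.and (hU.mem_nhds hx))
  refine ⟨V, c', fun z hz => (hV z hz).2, hVo, hxV, fun A hA => ?_⟩
  refine presents_of_pointwise hVo fun y hy f F hF => ?_
  rw [hA f y (hV y hy).2, LinearMap.sum_apply, sum_apply_smooth]
  refine Finset.sum_congr rfl fun p hp => ?_
  rw [((hV y hy).1 p hp).self_eq, hF.chartDeriv (hUe (hV y hy).2)]
  rfl

theorem locallyPresented_of_isDiffOp {A : Op d M} (hA : IsDiffOp A) (he : e ∈ holCharts d M)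
    (hx : x ∈ e.source) : LocallyPresented e x A := by
  obtain ⟨U, hUe, hU, hxU, T, c, hc, h⟩ := hA e he x hx
  obtain ⟨V, c', hVU, hV, hxV, hP⟩ := exists_presents he hU hUe hxU T c id hc
  exact ⟨V, hVU.trans hUe, hV, hxV, _,
    Submodule.sum_mem _ fun p _ => Submodule.smul_mem _ _ (pd_mem_DOp p), hP A h⟩

theorem isDiffOp_of_locallyPresented {A : Op d M}
    (h : ∀ e ∈ holCharts d M, ∀ x ∈ e.source, LocallyPresented e x A) : IsDiffOp A := by
  intro e he x hx
  obtain ⟨U, hUe, hU, hxU, A', hA', hP⟩ := h e he x hx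
  obtain ⟨T, c, rfl⟩ := exists_sum_of_mem_DOp hA'
  refine ⟨U, hUe, hU, hxU, T, fun p z => (c p).1 (e z),
    fun p _ => (smoothOn_comp_chart he (c p)).mono hUe, fun f y hy => ?_⟩
  obtain ⟨F, hF⟩ := exists_rep_smooth he (hUe hy) f
  rw [(hP y hy f F hF).self_eq, LinearMap.sum_apply, sum_apply_smooth]
  refine Finset.sum_congr rfl fun p _ => ?_
  rw [hF.chartDeriv (hUe hy)]
  rfl

theorem Presents.exists_hasSymbol {A : Op d M} {A' : Op d (Cn d)} (h : Presents e U A A')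
    (hA' : A' ∈ DOp d) (hy : y ∈ U) : ∃ P, HasSymbol e y A P := by
  obtain ⟨P, hP⟩ := exists_symb_of_mem_DOp hA' (e y)
  exact ⟨P, fun f F hF => by rw [(h y hy f F hF).self_eq, hP]⟩

theorem IsDiffOp.exists_hasSymbol {A : Op d M} (hA : IsDiffOp A) (he : e ∈ holCharts d M)
    (hy : y ∈ e.source) : ∃ P, HasSymbol e y A P := by
  obtain ⟨U, -, -, hyU, A', hA', hP⟩ := locallyPresented_of_isDiffOp hA he hy
  exact hP.exists_hasSymbol hA' hyU

theorem LocallyPresented.add {A B : Op d M} (hA : LocallyPresented e x A)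
    (hB : LocallyPresented e x B) : LocallyPresented e x (A + B) := by
  obtain ⟨U, hUe, hU, hxU, A', hA', hPA⟩ := hA
  obtain ⟨V, -, hV, hxV, B', hB', hPB⟩ := hB
  exact ⟨U ∩ V, Set.inter_subset_left.trans hUe, hU.inter hV, ⟨hxU, hxV⟩, A' + B',
    add_mem hA' hB', fun y hy f F hF => (hPA y hy.1 f F hF).add (hPB y hy.2 f F hF)⟩

theorem LocallyPresented.mul {A B : Op d M} (hA : LocallyPresented e x A)
    (hB : LocallyPresented e x B) : LocallyPresented e x (A * B) := by
  obtain ⟨U, hUe, hU, hxU, A', hA', hPA⟩ := hA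
  obtain ⟨V, -, hV, hxV, B', hB', hPB⟩ := hB
  exact ⟨U ∩ V, Set.inter_subset_left.trans hUe, hU.inter hV, ⟨hxU, hxV⟩, A' * B',
    mul_mem_DOp hA' hB', fun y hy f F hF => hPA y hy.1 _ _ (hPB y hy.2 f F hF)⟩

/-- Multiplication by a smooth function. -/
def mulOp : Smooth d M →ₐ[ℂ] Op d M := Algebra.lmul ℂ (Smooth d M)

theorem locallyPresented_mulOp (he : e ∈ holCharts d M) (hx : x ∈ e.source) (a : Smooth d M) :
    LocallyPresented e x (mulOp a) := by
  obtain ⟨F, hF⟩ := exists_rep_smooth he hx a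
  obtain ⟨V, hV, hVo, hxV⟩ :=
    eventually_nhds_iff.1 (hF.eventually.and (e.open_source.mem_nhds hx))
  exact ⟨V, fun z hz => (hV z hz).2, hVo, hxV, F • 1, Submodule.smul_mem _ _ one_mem_DOp,
    fun y hy f G hG => (hV y hy).1.mul hG⟩

variable (d M) in
/-- The algebra of differential operators on `M`. -/
def diffOps : Subalgebra ℂ (Op d M) where
  carrier := {A | IsDiffOp A}
  add_mem' hA hB := isDiffOp_of_locallyPresented fun _ he _ hx =>
    (locallyPresented_of_isDiffOp hA he hx).add (locallyPresented_of_isDiffOp hB he hx)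
  mul_mem' hA hB := isDiffOp_of_locallyPresented fun _ he _ hx =>
    (locallyPresented_of_isDiffOp hA he hx).mul (locallyPresented_of_isDiffOp hB he hx)
  algebraMap_mem' c := by
    have h : algebraMap ℂ (Op d M) c = mulOp (algebraMap ℂ (Smooth d M) c) :=
      (mulOp.commutes c).symm
    rw [h]
    exact isDiffOp_of_locallyPresented fun _ he _ hx => locallyPresented_mulOp he hx _

theorem mulOp_mem_diffOps (a : Smooth d M) : mulOp a ∈ diffOps d M :=
  isDiffOp_of_locallyPresented fun _ he _ hx => locallyPresented_mulOp he hx a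

/-- An operator whose symbols have degree at most `r` is of order at most `r`. -/
theorem exists_local_form_of_degree_le {A : Op d M} (hA : IsDiffOp A) (he : e ∈ holCharts d M)
    (hU : IsOpen U) (hx : x ∈ e.source) (hxU : x ∈ U) {r : ℕ}
    (hr : ∀ y ∈ U, ∀ P, HasSymbol e y A P → ∀ m : Dir d →₀ ℕ, r < m.degree → P.coeff m = 0) :
    ∃ V ⊆ e.source, IsOpen V ∧ x ∈ V ∧
      ∃ (T : Finset (MIdx d × MIdx d)) (c : MIdx d × MIdx d → M → ℂ),
        (∀ p ∈ T, ∑ i, p.1 i + ∑ i, p.2 i ≤ r) ∧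
        (∀ p ∈ T, SmoothOn (d := d) (c p) V) ∧
        ∀ (f : Smooth d M), ∀ y ∈ V, (A f).1 y = ∑ p ∈ T, c p y * chartDeriv e p f.1 y := by
  classical
  obtain ⟨W, hWe, hW, hxW, A', hA', hP⟩ := locallyPresented_of_isDiffOp hA he hx
  obtain ⟨T, c, rfl⟩ := exists_sum_of_mem_DOp hA'
  refine ⟨U ∩ W, Set.inter_subset_right.trans hWe, hU.inter hW, ⟨hxU, hxW⟩,
    T.filter fun p => ∑ i, p.1 i + ∑ i, p.2 i ≤ r, fun p z => (c p).1 (e z),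
    fun p hp => (Finset.mem_filter.1 hp).2,
    fun p _ => (smoothOn_comp_chart he (c p)).mono (Set.inter_subset_right.trans hWe),
    fun f y hy => ?_⟩
  have hform : ∀ (f : Smooth d M) (F : Smooth d (Cn d)), Rep e y F f.1 →
      (A f).1 y = ∑ p ∈ T, (c p).1 (e y) * (pd p F).1 (e y) := by
    intro f F hF
    rw [(hP y hy.2 f F hF).self_eq, LinearMap.sum_apply, sum_apply_smooth]
    rfl
  have hsym : HasSymbol e y A
      (∑ p ∈ T, MvPolynomial.monomial (dirExp p) ((c p).1 (e y))) := by
    intro f F hF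
    rw [hform f F hF, map_sum, LinearMap.sum_apply, sum_apply_smooth]
    refine Finset.sum_congr rfl fun p _ => ?_
    have h : MvPolynomial.monomial (dirExp p) ((c p).1 (e y)) =
        (c p).1 (e y) • MvPolynomial.monomial (dirExp p) (1 : ℂ) := by
      rw [MvPolynomial.smul_monomial, smul_eq_mul, mul_one]
    rw [h, map_smul]
    rfl
  obtain ⟨F, hF⟩ := exists_rep_smooth he (hWe hy.2) f
  rw [hform f F hF, Finset.sum_filter]
  refine Finset.sum_congr rfl fun p hp => ?_
  split_ifs with hle
  · rw [hF.chartDeriv (hWe hy.2)]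
  · have h1 := hr y hy.1 _ hsym (dirExp p) (by rw [degree_dirExp]; omega)
    rw [MvPolynomial.coeff_sum, Finset.sum_eq_single p] at h1
    · rw [MvPolynomial.coeff_monomial, if_pos rfl] at h1
      rw [h1, zero_mul]
    · intro q _ hqp
      rw [MvPolynomial.coeff_monomial, if_neg fun h => hqp (dirExp_injective h)]
    · exact fun h => absurd hp h

/-! ### Testing operators on products of holomorphic and antiholomorphic functions -/

/-- `f` is holomorphic near `y`. -/
def HolNear (d : ℕ) {M : Type*} [TopologicalSpace M] [ChartedSpace (Cn d) M] (y : M)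
    (f : M → ℂ) : Prop :=
  ∃ U, IsOpen U ∧ y ∈ U ∧ HolOn (d := d) f U

/-- `f` is antiholomorphic near `y`. -/
def AntiholNear (d : ℕ) {M : Type*} [TopologicalSpace M] [ChartedSpace (Cn d) M] (y : M)
    (f : M → ℂ) : Prop :=
  HolNear d y fun x => (starRingEnd ℂ) (f x)

theorem HolNear.eventually {f : M → ℂ} (h : HolNear d y f) : ∀ᶠ z in nhds y, HolNear d z f := by
  obtain ⟨U, hU, hyU, hf⟩ := h
  filter_upwards [hU.mem_nhds hyU] with z hz
  exact ⟨U, hU, hz, hf⟩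

theorem HolNear.mul {f g : M → ℂ} (hf : HolNear d y f) (hg : HolNear d y g) :
    HolNear d y (f * g) := by
  obtain ⟨U, hU, hyU, hf⟩ := hf
  obtain ⟨V, hV, hyV, hg⟩ := hg
  refine ⟨U ∩ V, hU.inter hV, ⟨hyU, hyV⟩, ?_⟩
  have h : Differentiable ℂ (fun p : ℂ × ℂ => p.1 * p.2) := differentiable_fst.mul differentiable_snd
  exact h.mdifferentiable.comp_mdifferentiableOn
    ((hf.mono Set.inter_subset_left).prodMk_space (hg.mono Set.inter_subset_right))

theorem AntiholNear.mul {f g : M → ℂ} (hf : AntiholNear d y f) (hg : AntiholNear d y g) :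
    AntiholNear d y (f * g) := by
  have h := HolNear.mul hf hg
  have h2 : (fun x => (starRingEnd ℂ) ((f * g) x)) =
      (fun x => (starRingEnd ℂ) (f x)) * fun x => (starRingEnd ℂ) (g x) := by
    funext x; simp
  rw [AntiholNear, h2]
  exact h

theorem holNear_of_rep (he : e ∈ holCharts d M) (hy : y ∈ e.source) {F : Smooth d (Cn d)}
    {f : M → ℂ} (hF : Differentiable ℂ F.1) (h : Rep e y F f) : HolNear d y f := by
  have h1 : HolOn (d := d) (fun z => F.1 (e z)) e.source :=
    hF.mdifferentiable.comp_mdifferentiableOn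
      ((contMDiffOn_of_mem_maximalAtlas he).mdifferentiableOn (by simp))
  obtain ⟨V, hV, hVo, hyV⟩ := eventually_nhds_iff.1 (Filter.Eventually.and h (e.open_source.mem_nhds hy))
  exact ⟨V, hVo, hyV, (h1.mono fun z hz => (hV z hz).2).congr fun z hz => (hV z hz).1.symm⟩

theorem antiholNear_of_rep (he : e ∈ holCharts d M) (hy : y ∈ e.source) {F : Smooth d (Cn d)}
    {f : M → ℂ} (hF : Differentiable ℂ fun z => (starRingEnd ℂ) (F.1 z)) (h : Rep e y F f) :
    AntiholNear d y f := by
  have h1 : HolOn (d := d) (fun z => (starRingEnd ℂ) (F.1 (e z))) e.source :=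
    hF.mdifferentiable.comp_mdifferentiableOn
      ((contMDiffOn_of_mem_maximalAtlas he).mdifferentiableOn (by simp))
  obtain ⟨V, hV, hVo, hyV⟩ := eventually_nhds_iff.1 (Filter.Eventually.and h (e.open_source.mem_nhds hy))
  refine ⟨V, hVo, hyV, (h1.mono fun z hz => (hV z hz).2).congr fun z hz => ?_⟩
  exact congrArg _ (hV z hz).1.symm

theorem HolNear.D_inr_eq_zero (he : e ∈ holCharts d M) (hy : y ∈ e.source) {f : M → ℂ}
    {F : Smooth d (Cn d)} (hf : HolNear d y f) (hF : Rep e y F f) (k : Fin d) :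
    (D (.inr k) F).1 =ᶠ[nhds (e y)] 0 := by
  obtain ⟨U, hU, hyU, hf⟩ := hf
  exact D_inr_eq_zero_of_holOn he hU hy hyU hf hF k

theorem AntiholNear.D_inl_eq_zero (he : e ∈ holCharts d M) (hy : y ∈ e.source) {f : M → ℂ}
    {F : Smooth d (Cn d)} (hf : AntiholNear d y f) (hF : Rep e y F f) (k : Fin d) :
    (D (.inl k) F).1 =ᶠ[nhds (e y)] 0 := by
  obtain ⟨U, hU, hyU, hf⟩ := hf
  exact D_inl_eq_zero_of_antiholOn he hU hy hyU hf hF k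

theorem differentiable_expo_inl (a : Fin d → ℂ) :
    Differentiable ℂ (expo (Sum.elim a (0 : Fin d → ℂ))).1 := by
  have h : (expo (Sum.elim a (0 : Fin d → ℂ))).1 = fun z => Complex.exp (∑ k, a k * z k) := by
    funext z
    simp [expo, linForm, Fintype.sum_sum_type]
  rw [h]
  fun_prop

theorem differentiable_conj_expo_inr (b : Fin d → ℂ) :
    Differentiable ℂ fun z => (starRingEnd ℂ) ((expo (Sum.elim (0 : Fin d → ℂ) b)).1 z) := by
  have h : (fun z => (starRingEnd ℂ) ((expo (Sum.elim (0 : Fin d → ℂ) b)).1 z)) =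
      fun z => Complex.exp (∑ k, (starRingEnd ℂ) (b k) * z k) := by
    funext z
    simp [expo, linForm, Fintype.sum_sum_type, ← Complex.exp_conj]
  rw [h]
  fun_prop

theorem expo_mul (κ : Dir d → ℂ) :
    expo (Sum.elim (fun k => κ (.inl k)) (0 : Fin d → ℂ)) *
      expo (Sum.elim (0 : Fin d → ℂ) fun k => κ (.inr k)) = expo κ := by
  ext z
  change Complex.exp _ * Complex.exp _ = Complex.exp _
  rw [← Complex.exp_add]
  simp [linForm, Fintype.sum_sum_type]

/-- Two operators with constant coefficients agree if, read in a chart, they agree at one point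
on all products of a holomorphic and an antiholomorphic function. -/
theorem symb_eq_of_eq_on_products [T2Space M] [IsManifold 𝓘(ℂ, Cn d) ω M]
    (he : e ∈ holCharts d M) (hy : y ∈ e.source) {P Q : MvPolynomial (Dir d) ℂ}
    (h : ∀ (a b : Smooth d M) (F G : Smooth d (Cn d)), HolNear d y a.1 → AntiholNear d y b.1 →
      Rep e y F a.1 → Rep e y G b.1 → (symb P (F * G)).1 (e y) = (symb Q (F * G)).1 (e y)) :
    P = Q := by
  refine symb_ext (e y) fun κ => ?_
  rw [← expo_mul κ]
  obtain ⟨a, ha⟩ := exists_smooth_rep he hy (expo (Sum.elim (fun k => κ (.inl k)) (0 : Fin d → ℂ)))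
  obtain ⟨b, hb⟩ := exists_smooth_rep he hy (expo (Sum.elim (0 : Fin d → ℂ) fun k => κ (.inr k)))
  exact h a b _ _ (holNear_of_rep he hy (differentiable_expo_inl _) ha)
    (antiholNear_of_rep he hy (differentiable_conj_expo_inr _) hb) ha hb

theorem HasSymbol.eq_of_eq_on_products [T2Space M] [IsManifold 𝓘(ℂ, Cn d) ω M]
    (he : e ∈ holCharts d M) (hy : y ∈ e.source) {A B : Op d M}
    {P Q : MvPolynomial (Dir d) ℂ} (hA : HasSymbol e y A P) (hB : HasSymbol e y B Q)
    (h : ∀ a b : Smooth d M, HolNear d y a.1 → AntiholNear d y b.1 →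
      (A (a * b)).1 y = (B (a * b)).1 y) : P = Q :=
  symb_eq_of_eq_on_products he hy fun a b F G ha hb hF hG => by
    rw [← hA (a * b) (F * G) (hF.mul hG), ← hB (a * b) (F * G) (hF.mul hG), h a b ha hb]

theorem HasSymbol.unique [T2Space M] [IsManifold 𝓘(ℂ, Cn d) ω M]
    (he : e ∈ holCharts d M) (hy : y ∈ e.source) {A : Op d M}
    {P Q : MvPolynomial (Dir d) ℂ} (hP : HasSymbol e y A P) (hQ : HasSymbol e y A Q) : P = Q :=
  hP.eq_of_eq_on_products he hy hQ fun _ _ _ _ => rfl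

theorem HasSymbol.apply_eq (he : e ∈ holCharts d M) (hy : y ∈ e.source) {A B : Op d M}
    {P : MvPolynomial (Dir d) ℂ} (hA : HasSymbol e y A P) (hB : HasSymbol e y B P)
    (f : Smooth d M) : (A f).1 y = (B f).1 y := by
  obtain ⟨F, hF⟩ := exists_rep_smooth he hy f
  rw [hA f F hF, hB f F hF]

/-- A differential operator is determined by its values on the products of holomorphic and
antiholomorphic functions. -/
theorem IsDiffOp.apply_eq_of_eq_on_products [T2Space M] [IsManifold 𝓘(ℂ, Cn d) ω M]
    {A B : Op d M} (hA : IsDiffOp A) (hB : IsDiffOp B) (y : M)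
    (h : ∀ a b : Smooth d M, HolNear d y a.1 → AntiholNear d y b.1 →
      (A (a * b)).1 y = (B (a * b)).1 y) (f : Smooth d M) : (A f).1 y = (B f).1 y := by
  have he : chartAt (Cn d) y ∈ holCharts d M := IsManifold.chart_mem_maximalAtlas y
  have hy := mem_chart_source (Cn d) y
  obtain ⟨P, hP⟩ := hA.exists_hasSymbol he hy
  obtain ⟨Q, hQ⟩ := hB.exists_hasSymbol he hy
  have hPQ := hP.eq_of_eq_on_products he hy hQ h
  subst hPQ
  exact hP.apply_eq he hy hQ f

theorem IsDiffOp.apply_eq_of_eventuallyEq [IsManifold 𝓘(ℂ, Cn d) ω M] {A : Op d M}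
    (hA : IsDiffOp A) {f g : Smooth d M} (hfg : f.1 =ᶠ[nhds y] g.1) : (A f).1 y = (A g).1 y := by
  have he : chartAt (Cn d) y ∈ holCharts d M := IsManifold.chart_mem_maximalAtlas y
  have hy := mem_chart_source (Cn d) y
  obtain ⟨P, hP⟩ := hA.exists_hasSymbol he hy
  obtain ⟨F, hF⟩ := exists_rep_smooth he hy f
  rw [hP f F hF, hP g F (hF.congr hfg)]

/-- The commutator with a coordinate function differentiates the symbol. -/
theorem HasSymbol.commutator_coord {A : Op d M} {P : MvPolynomial (Dir d) ℂ} (hA : HasSymbol e y A P)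
    {i : Dir d} {c : Smooth d M} (hc : Rep e y (coord i) c.1) :
    HasSymbol e y (A * mulOp c - mulOp c * A) (MvPolynomial.pderiv i P) := by
  intro f F hF
  have h1 := hA (c * f) (coord i * F) (hc.mul hF)
  rw [symb_coord_mul] at h1
  have h2 := hA f F hF
  change (A (c * f)).1 y - c.1 y * (A f).1 y = _
  rw [h1, h2, hc.self_eq]
  exact add_sub_cancel_left ((coord i).1 (e y) * (symb P F).1 (e y)) _

end Operators

/-! ### The operator `ab ↦ C(b, a)` -/

/-- The symbol `∑ c_{βα} ∂^α ∂̄^β` at the point `y`, for a bidifferential operator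
`C(f, g) = ∑ c_{βα} ∂̄^β f ∂^α g`; the pairs in `T` are `(β, α)`. -/
def swapSymbol {d : ℕ} {M : Type*} (T : Finset (MIdx d × MIdx d))
    (c : MIdx d × MIdx d → M → ℂ) (y : M) : MvPolynomial (Dir d) ℂ :=
  ∑ p ∈ T, c p y • MvPolynomial.monomial (dirExp (p.2, p.1)) (1 : ℂ)

theorem symb_swapSymbol {d : ℕ} {M : Type*} (T : Finset (MIdx d × MIdx d))
    (c : MIdx d × MIdx d → M → ℂ) (y : M) (F : Smooth d (Cn d)) (z : Cn d) :
    (symb (swapSymbol T c y) F).1 z = ∑ p ∈ T, c p y * (pd (p.2, p.1) F).1 z := by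
  rw [swapSymbol, map_sum, LinearMap.sum_apply, sum_apply_smooth]
  refine Finset.sum_congr rfl fun p _ => ?_
  rw [map_smul]
  rfl

section BerezinOperator

variable {d : ℕ} {M : Type*} [TopologicalSpace M] [ChartedSpace (Cn d) M]
  {e : OpenPartialHomeomorph M (Cn d)} {x y : M} {U : Set M}

/-- `P` is the symbol, at the point `y` in the chart `e`, of the operator that maps `ab` to
`C(b, a)` for `a` holomorphic and `b` antiholomorphic. -/
def IsBerezinSymbol (e : OpenPartialHomeomorph M (Cn d)) (y : M) (C : BiOp d M)
    (P : MvPolynomial (Dir d) ℂ) : Prop :=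
  ∀ (a b : Smooth d M) (F G : Smooth d (Cn d)), HolNear d y a.1 → AntiholNear d y b.1 →
    Rep e y F a.1 → Rep e y G b.1 → (C b a).1 y = (symb P (F * G)).1 (e y)

theorem isBerezinSymbol_swapSymbol [IsManifold 𝓘(ℂ, Cn d) ω M] (he : e ∈ holCharts d M)
    (hy : y ∈ e.source) {C : BiOp d M} {T : Finset (MIdx d × MIdx d)}
    {c : MIdx d × MIdx d → M → ℂ}
    (h : ∀ f g : Smooth d M, (C f g).1 y =
      ∑ p ∈ T, c p y * chartDeriv e (0, p.1) f.1 y * chartDeriv e (p.2, 0) g.1 y) :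
    IsBerezinSymbol e y C (swapSymbol T c y) := by
  intro a b F G ha hb hF hG
  rw [h, symb_swapSymbol]
  refine Finset.sum_congr rfl fun p _ => ?_
  rw [hF.chartDeriv hy, hG.chartDeriv hy, (pd_mul_of_hol_of_antihol
    (ha.D_inr_eq_zero he hy hF) (hb.D_inl_eq_zero he hy hG) (p.2, p.1)).eq_of_nhds]
  change _ = c p y * ((pd (p.2, 0) F).1 (e y) * (pd (0, p.1) G).1 (e y))
  ring

/-- A change of charts, extended to a smooth map of `ℂ^d`. -/
theorem exists_transition {e e' : OpenPartialHomeomorph M (Cn d)} (he : e ∈ holCharts d M)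
    (he' : e' ∈ holCharts d M) (hy : y ∈ e.source) (hy' : y ∈ e'.source) :
    ∃ φ : Cn d → Cn d, ContDiff ℝ ∞ φ ∧ ∀ᶠ z in nhds y, φ (e' z) = e z := by
  have h1 : ∀ k : Fin d, ∃ F, Rep e' y F (fun z => e z k) := fun k =>
    exists_rep (U := e'.source ∩ e.source) he' (e'.open_source.inter e.open_source)
      Set.inter_subset_left ⟨hy', hy⟩
      ((smoothOn_comp_chart he (coord (.inl k))).mono Set.inter_subset_right)
  choose F hF using h1
  refine ⟨fun w k => (F k).1 w, contDiff_pi.2 fun k => contDiff_val (F k), ?_⟩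
  filter_upwards [Filter.eventually_all.2 hF] with z hz
  exact funext hz

/-- The value of the operator with a given Berezin symbol does not depend on the chart: both
symbols, read in one chart, agree on products of holomorphic and antiholomorphic functions, and so
they are equal. -/
theorem IsBerezinSymbol.value_eq [T2Space M] [IsManifold 𝓘(ℂ, Cn d) ω M]
    {e e' : OpenPartialHomeomorph M (Cn d)} (he : e ∈ holCharts d M)
    (he' : e' ∈ holCharts d M) (hy : y ∈ e.source) (hy' : y ∈ e'.source) {C : BiOp d M}
    {P P' : MvPolynomial (Dir d) ℂ} (hP : IsBerezinSymbol e y C P)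
    (hP' : IsBerezinSymbol e' y C P') {f : Smooth d M} {F F' : Smooth d (Cn d)}
    (hF : Rep e y F f.1) (hF' : Rep e' y F' f.1) :
    (symb P F).1 (e y) = (symb P' F').1 (e' y) := by
  obtain ⟨φ, hφ, hφe⟩ := exists_transition he he' hy hy'
  have hrep : ∀ {g : M → ℂ} {G : Smooth d (Cn d)}, Rep e y G g → Rep e' y (pullback φ hφ G) g := by
    intro g G hG
    filter_upwards [hG, hφe] with z hz hzφ
    rw [pullback_apply, hzφ, hz]
  obtain ⟨Q, hQ⟩ := exists_symb_pullback φ hφ P' (e' y)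
  rw [hφe.self_of_nhds] at hQ
  have hPQ : P = Q := symb_eq_of_eq_on_products he hy fun a b F G ha hb hF hG => by
    rw [← hP a b F G ha hb hF hG, ← hQ]
    exact hP' a b _ _ ha hb (hrep hF) (hrep hG)
  rw [hPQ, ← hQ]
  exact (symb_congr ((hrep hF).eventuallyEq hy' hF') P').eq_of_nhds

/-- For a bidifferential operator `C` with separation of variables there is a differential
operator that maps `ab` to `C(b, a)` for `a` holomorphic and `b` antiholomorphic. -/
theorem exists_berezinOp [T2Space M] [IsManifold 𝓘(ℂ, Cn d) ω M] {C : BiOp d M}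
    (hC : SeparatesVariables C) :
    ∃ B : Op d M, IsDiffOp B ∧ ∀ (y : M) (a b : Smooth d M), HolNear d y a.1 →
      AntiholNear d y b.1 → (B (a * b)).1 y = (C b a).1 y := by
  have hchart : ∀ y : M, chartAt (Cn d) y ∈ holCharts d M := fun y =>
    IsManifold.chart_mem_maximalAtlas y
  have hex : ∀ e ∈ holCharts d M, ∀ y ∈ e.source, ∃ P, IsBerezinSymbol e y C P := by
    intro e he y hy
    obtain ⟨U, -, -, hyU, T, c, -, h⟩ := hC e he y hy
    exact ⟨_, isBerezinSymbol_swapSymbol he hy fun f g => h f g y hyU⟩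
  -- the value of `B f` at `y` is computed in any chart at `y`
  have hval : ∀ (f : Smooth d M) (y : M), ∃ v : ℂ, ∀ e ∈ holCharts d M, y ∈ e.source →
      ∀ P F, IsBerezinSymbol e y C P → Rep e y F f.1 → v = (symb P F).1 (e y) := by
    intro f y
    obtain ⟨P, hP⟩ := hex _ (hchart y) y (mem_chart_source _ y)
    obtain ⟨F, hF⟩ := exists_rep_smooth (hchart y) (mem_chart_source _ y) f
    exact ⟨_, fun e he hy P' F' hP' hF' =>
      hP.value_eq (hchart y) he (mem_chart_source _ y) hy hP' hF hF'⟩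
  choose v hv using hval
  have hlocal : ∀ e ∈ holCharts d M, ∀ x ∈ e.source, ∃ U ⊆ e.source, IsOpen U ∧ x ∈ U ∧
      ∃ (T : Finset (MIdx d × MIdx d)) (c : MIdx d × MIdx d → M → ℂ),
      (∀ p ∈ T, SmoothOn (d := d) (c p) U) ∧
      ∀ (f : Smooth d M), ∀ y ∈ U, v f y = ∑ p ∈ T, c p y * chartDeriv e (p.2, p.1) f.1 y := by
    intro e he x hx
    obtain ⟨U, hUe, hU, hxU, T, c, hc, h⟩ := hC e he x hx
    refine ⟨U, hUe, hU, hxU, T, c, hc, fun f y hy => ?_⟩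
    obtain ⟨F, hF⟩ := exists_rep_smooth he (hUe hy) f
    rw [hv f y e he (hUe hy) _ F
      (isBerezinSymbol_swapSymbol he (hUe hy) fun f g => h f g y hy) hF, symb_swapSymbol]
    exact Finset.sum_congr rfl fun p _ => by rw [hF.chartDeriv (hUe hy)]
  have hsmooth : ∀ f, v f ∈ Smooth d M := by
    intro f x
    obtain ⟨U, hUe, hU, hxU, T, c, hc, h⟩ := hlocal _ (hchart x) x (mem_chart_source _ x)
    have h1 : SmoothOn (d := d)
        (fun y => ∑ p ∈ T, c p y * chartDeriv (chartAt (Cn d) x) (p.2, p.1) f.1 y) U :=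
      smoothOn_sum T fun p hp => smoothOn_mul (hc p hp)
        ((smoothOn_chartDeriv (hchart x) _ f).mono hUe)
    refine (h1.contMDiffAt (hU.mem_nhds hxU)).congr_of_eventuallyEq ?_
    filter_upwards [hU.mem_nhds hxU] with y hy
    exact h f y hy
  let B : Op d M :=
    { toFun := fun f => ⟨v f, hsmooth f⟩
      map_add' := fun f g => by
        ext y
        obtain ⟨P, hP⟩ := hex _ (hchart y) y (mem_chart_source _ y)
        obtain ⟨F, hF⟩ := exists_rep_smooth (hchart y) (mem_chart_source _ y) f
        obtain ⟨G, hG⟩ := exists_rep_smooth (hchart y) (mem_chart_source _ y) g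
        change v (f + g) y = v f y + v g y
        rw [hv _ y _ (hchart y) (mem_chart_source _ y) P _ hP hF,
          hv _ y _ (hchart y) (mem_chart_source _ y) P _ hP hG,
          hv _ y _ (hchart y) (mem_chart_source _ y) P _ hP (hF.add hG), map_add]
        rfl
      map_smul' := fun t f => by
        ext y
        obtain ⟨P, hP⟩ := hex _ (hchart y) y (mem_chart_source _ y)
        obtain ⟨F, hF⟩ := exists_rep_smooth (hchart y) (mem_chart_source _ y) f
        change v (t • f) y = t * v f y
        rw [hv _ y _ (hchart y) (mem_chart_source _ y) P _ hP hF,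
          hv _ y _ (hchart y) (mem_chart_source _ y) P _ hP (hF.smul t), map_smul]
        rfl }
  refine ⟨B, isDiffOp_of_locallyPresented fun e he x hx => ?_, fun y a b ha hb => ?_⟩
  · obtain ⟨U, hUe, hU, hxU, T, c, hc, h⟩ := hlocal e he x hx
    obtain ⟨V, c', hVU, hV, hxV, hP⟩ := exists_presents he hU hUe hxU T c (fun p => (p.2, p.1)) hc
    exact ⟨V, hVU.trans hUe, hV, hxV, _,
      Submodule.sum_mem _ fun p _ => Submodule.smul_mem _ _ (pd_mem_DOp _), hP B h⟩
  · obtain ⟨P, hP⟩ := hex _ (hchart y) y (mem_chart_source _ y)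
    obtain ⟨F, hF⟩ := exists_rep_smooth (hchart y) (mem_chart_source _ y) a
    obtain ⟨G, hG⟩ := exists_rep_smooth (hchart y) (mem_chart_source _ y) b
    rw [hP a b F G ha hb hF hG]
    exact hv _ y _ (hchart y) (mem_chart_source _ y) P _ hP (hF.mul hG)

end BerezinOperator

/-! ### Bidifferential operators with separation of variables -/

section Separation

variable {d : ℕ} {M : Type*} [TopologicalSpace M] [ChartedSpace (Cn d) M]
  {C : BiOp d M} {y : M}

theorem SeparatesVariables.isDiffOp_left (hC : SeparatesVariables C) (f : Smooth d M) :
    IsDiffOp (C f) := by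
  refine isDiffOp_of_locallyPresented fun e he x hx => ?_
  obtain ⟨U, hUe, hU, hxU, T, c, hc, h⟩ := hC e he x hx
  obtain ⟨V, c', hVU, hV, hxV, hP⟩ := exists_presents he hU hUe hxU T
    (fun p y => c p y * chartDeriv e (0, p.1) f.1 y) (fun p => (p.2, 0))
    (fun p hp => smoothOn_mul (hc p hp) ((smoothOn_chartDeriv he _ f).mono hUe))
  exact ⟨V, hVU.trans hUe, hV, hxV, _,
    Submodule.sum_mem _ fun p _ => Submodule.smul_mem _ _ (pd_mem_DOp _), hP _ (h f)⟩

theorem SeparatesVariables.isDiffOp_right (hC : SeparatesVariables C) (g : Smooth d M) :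
    IsDiffOp (C.flip g) := by
  refine isDiffOp_of_locallyPresented fun e he x hx => ?_
  obtain ⟨U, hUe, hU, hxU, T, c, hc, h⟩ := hC e he x hx
  obtain ⟨V, c', hVU, hV, hxV, hP⟩ := exists_presents he hU hUe hxU T
    (fun p y => c p y * chartDeriv e (p.2, 0) g.1 y) (fun p => (0, p.1))
    (fun p hp => smoothOn_mul (hc p hp) ((smoothOn_chartDeriv he _ g).mono hUe))
  refine ⟨V, hVU.trans hUe, hV, hxV, _,
    Submodule.sum_mem _ fun p _ => Submodule.smul_mem _ _ (pd_mem_DOp _), hP _ fun f y hy => ?_⟩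
  rw [LinearMap.flip_apply, h f g y hy]
  exact Finset.sum_congr rfl fun p _ => by ring

variable [IsManifold 𝓘(ℂ, Cn d) ω M]

theorem SeparatesVariables.hol_mul_left (hC : SeparatesVariables C) {a : Smooth d M}
    (ha : HolNear d y a.1) (f g : Smooth d M) : (C (a * f) g).1 y = a.1 y * (C f g).1 y := by
  have he : chartAt (Cn d) y ∈ holCharts d M := IsManifold.chart_mem_maximalAtlas y
  have hy := mem_chart_source (Cn d) y
  obtain ⟨U, -, -, hyU, T, c, -, h⟩ := hC _ he y hy
  obtain ⟨A, hA⟩ := exists_rep_smooth he hy a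
  obtain ⟨F, hF⟩ := exists_rep_smooth he hy f
  rw [h _ _ y hyU, h _ _ y hyU, Finset.mul_sum]
  refine Finset.sum_congr rfl fun p _ => ?_
  have hFA : Rep (chartAt (Cn d) y) y (F * A) (f * a).1 := hF.mul hA
  rw [mul_comm a f, hFA.chartDeriv hy, hF.chartDeriv hy,
    (pd_inr_mul_of_hol (ha.D_inr_eq_zero he hy hA) p.1).eq_of_nhds, hA.self_eq]
  change c p y * ((pd (0, p.1) F).1 _ * A.1 _) * _ = _
  ring

theorem SeparatesVariables.antihol_mul_right (hC : SeparatesVariables C) {b : Smooth d M}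
    (hb : AntiholNear d y b.1) (f g : Smooth d M) :
    (C f (b * g)).1 y = b.1 y * (C f g).1 y := by
  have he : chartAt (Cn d) y ∈ holCharts d M := IsManifold.chart_mem_maximalAtlas y
  have hy := mem_chart_source (Cn d) y
  obtain ⟨U, -, -, hyU, T, c, -, h⟩ := hC _ he y hy
  obtain ⟨A, hA⟩ := exists_rep_smooth he hy b
  obtain ⟨F, hF⟩ := exists_rep_smooth he hy g
  rw [h _ _ y hyU, h _ _ y hyU, Finset.mul_sum]
  refine Finset.sum_congr rfl fun p _ => ?_
  have hFA : Rep (chartAt (Cn d) y) y (F * A) (g * b).1 := hF.mul hA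
  rw [mul_comm b g, hFA.chartDeriv hy, hF.chartDeriv hy,
    (pd_inl_mul_of_antihol (hb.D_inl_eq_zero he hy hA) p.2).eq_of_nhds, hA.self_eq]
  change c p y * _ * ((pd (p.2, 0) F).1 _ * A.1 _) = _
  ring

end Separation

/-! ### Star products with separation of variables -/

section StarProducts

variable {d : ℕ} {M : Type*} [TopologicalSpace M] [ChartedSpace (Cn d) M]
  {P : Structure d M} (S : StarProduct P)

theorem coeff_formalMul_C_right (C : ℕ → BiOp d M) (F : PowerSeries (Smooth d M))
    (g : Smooth d M) (n : ℕ) : PowerSeries.coeff n (formalMul C F (PowerSeries.C g)) =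
      ∑ p ∈ Finset.HasAntidiagonal.antidiagonal n, C p.1 (PowerSeries.coeff p.2 F) g := by
  rw [formalMul, PowerSeries.coeff_mk]
  refine Finset.sum_congr rfl fun p _ => ?_
  rw [Finset.sum_eq_single (p.2, 0)]
  · simp
  · intro q hq hne
    have hq' := Finset.HasAntidiagonal.mem_antidiagonal.1 hq
    have : q.2 ≠ 0 := fun h0 => hne (Prod.ext (by simp; omega) h0)
    rw [PowerSeries.coeff_C, if_neg this, map_zero]
  · intro h
    exact absurd (Finset.HasAntidiagonal.mem_antidiagonal.2 (by simp)) h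

theorem coeff_formalMul_C_left (C : ℕ → BiOp d M) (f : Smooth d M)
    (G : PowerSeries (Smooth d M)) (n : ℕ) :
    PowerSeries.coeff n (formalMul C (PowerSeries.C f) G) =
      ∑ p ∈ Finset.HasAntidiagonal.antidiagonal n, C p.1 f (PowerSeries.coeff p.2 G) := by
  rw [formalMul, PowerSeries.coeff_mk]
  refine Finset.sum_congr rfl fun p _ => ?_
  rw [Finset.sum_eq_single (0, p.2)]
  · simp
  · intro q hq hne
    have hq' := Finset.HasAntidiagonal.mem_antidiagonal.1 hq
    have : q.1 ≠ 0 := fun h0 => hne (Prod.ext h0 (by simp; omega))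
    rw [PowerSeries.coeff_C, if_neg this, map_zero, LinearMap.zero_apply]
  · intro h
    exact absurd (Finset.HasAntidiagonal.mem_antidiagonal.2 (by simp)) h

theorem sum_antidiagonal_C {β : Type*} [AddCommMonoid β] (n : ℕ) (f : ℕ → Smooth d M → β)
    (hf : ∀ k, f k 0 = 0) (g : Smooth d M) :
    ∑ p ∈ Finset.HasAntidiagonal.antidiagonal n,
      f p.1 (PowerSeries.coeff p.2 (PowerSeries.C g)) = f n g := by
  rw [Finset.sum_eq_single (n, 0)]
  · simp
  · intro q hq hne
    have hq' := Finset.HasAntidiagonal.mem_antidiagonal.1 hq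
    have : q.2 ≠ 0 := fun h0 => hne (Prod.ext (by simp; omega) h0)
    rw [PowerSeries.coeff_C, if_neg this, hf]
  · intro h
    exact absurd (Finset.HasAntidiagonal.mem_antidiagonal.2 (by simp)) h

theorem coeff_formalMul_C_C (C : ℕ → BiOp d M) (f g : Smooth d M) (n : ℕ) :
    PowerSeries.coeff n (formalMul C (PowerSeries.C f) (PowerSeries.C g)) = C n f g := by
  rw [coeff_formalMul_C_left]
  exact sum_antidiagonal_C n (fun k h => C k f h) (fun k => map_zero _) g

theorem StarProduct.sum_assoc (f g h : Smooth d M) (n : ℕ) :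
    ∑ p ∈ Finset.HasAntidiagonal.antidiagonal n, S.C p.1 (S.C p.2 f g) h =
      ∑ p ∈ Finset.HasAntidiagonal.antidiagonal n, S.C p.1 f (S.C p.2 g h) := by
  have h1 := congrArg (PowerSeries.coeff n)
    (S.assoc (PowerSeries.C f) (PowerSeries.C g) (PowerSeries.C h))
  rw [coeff_formalMul_C_right, coeff_formalMul_C_left] at h1
  simpa only [coeff_formalMul_C_C] using h1

theorem StarProduct.one_C (f : Smooth d M) {n : ℕ} (hn : n ≠ 0) : S.C n 1 f = 0 := by
  have h1 := congrArg (PowerSeries.coeff n) (S.one_mul (PowerSeries.C f))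
  rw [← map_one (PowerSeries.C (R := Smooth d M)), coeff_formalMul_C_C, PowerSeries.coeff_C,
    if_neg hn] at h1
  exact h1

theorem StarProduct.C_one_right (f : Smooth d M) {n : ℕ} (hn : n ≠ 0) : S.C n f 1 = 0 := by
  have h1 := congrArg (PowerSeries.coeff n) (S.mul_one (PowerSeries.C f))
  rw [← map_one (PowerSeries.C (R := Smooth d M)), coeff_formalMul_C_C, PowerSeries.coeff_C,
    if_neg hn] at h1
  exact h1

variable {S}

theorem StarProduct.HasSeparation.C_of_hol_left [IsManifold 𝓘(ℂ, Cn d) ω M]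
    (hS : S.HasSeparation) {y : M} {a : Smooth d M} (ha : HolNear d y a.1) (f : Smooth d M)
    {n : ℕ} (hn : n ≠ 0) : (S.C n a f).1 y = 0 := by
  have h := (hS n).hol_mul_left ha 1 f
  rw [_root_.mul_one, S.one_C f hn] at h
  rw [h]
  exact MulZeroClass.mul_zero _

theorem StarProduct.HasSeparation.C_of_antihol_right [IsManifold 𝓘(ℂ, Cn d) ω M]
    (hS : S.HasSeparation) {y : M} {b : Smooth d M} (hb : AntiholNear d y b.1) (f : Smooth d M)
    {n : ℕ} (hn : n ≠ 0) : (S.C n f b).1 y = 0 := by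
  have h := (hS n).antihol_mul_right hb f 1
  rw [_root_.mul_one, S.C_one_right f hn] at h
  rw [h]
  exact MulZeroClass.mul_zero _

theorem isBerezin_iff {B : PowerSeries (Op d M)} :
    S.IsBerezin B ↔ (∀ r, IsDiffOp (PowerSeries.coeff r B)) ∧
      ∀ (r : ℕ) (y : M) (a b : Smooth d M), HolNear d y a.1 → AntiholNear d y b.1 →
        (PowerSeries.coeff r B (a * b)).1 y = (S.C r b a).1 y := by
  refine and_congr_right fun _ => ⟨fun h r y a b ha hb => ?_, fun h U hU a b ha hb r x hx => ?_⟩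
  · obtain ⟨U, hU, hyU, ha⟩ := ha
    obtain ⟨V, hV, hyV, hb⟩ := hb
    exact h (U ∩ V) (hU.inter hV) a b (ha.mono Set.inter_subset_left)
      (hb.mono Set.inter_subset_right) r y ⟨hyU, hyV⟩
  · exact h r x a b ⟨U, hU, hx, ha⟩ ⟨U, hU, hx, hb⟩

theorem StarProduct.HasSeparation.existsUnique_isBerezin [T2Space M] [IsManifold 𝓘(ℂ, Cn d) ω M]
    (hS : S.HasSeparation) : ∃! B : PowerSeries (Op d M), S.IsBerezin B := by
  choose B hB hBC using fun r => exists_berezinOp (hS r)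
  refine ⟨PowerSeries.mk B, isBerezin_iff.2 ⟨fun r => ?_, fun r y a b ha hb => ?_⟩, ?_⟩
  · rw [PowerSeries.coeff_mk]; exact hB r
  · rw [PowerSeries.coeff_mk]; exact hBC r y a b ha hb
  · intro B' hB'
    rw [isBerezin_iff] at hB'
    ext r f y
    rw [PowerSeries.coeff_mk]
    refine (hB'.1 r).apply_eq_of_eq_on_products (hB r) y (fun a b ha hb => ?_) f
    rw [hB'.2 r y a b ha hb, hBC r y a b ha hb]

end StarProducts

/-! ### The commutator filtration of differential operators -/

section LocalFiltration

variable {d : ℕ} {M : Type*} [TopologicalSpace M] [ChartedSpace (Cn d) M]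
  {W : Set M}

/-- The ring structure of the algebra of differential operators, as a shortcut for instance
search. -/
instance : Ring (diffOps d M) :=
  @Subalgebra.toRing ℂ (Op d M) _ Module.End.instRing _ (diffOps d M)

variable (d M) in
/-- The differential operators that vanish over `W`. -/
def vanishOn (W : Set M) : Submodule ℂ (diffOps d M) where
  carrier := {A | ∀ (f : Smooth d M), ∀ y ∈ W, (A.1 f).1 y = 0}
  add_mem' {A B} hA hB f y hy := by
    change (A.1 f).1 y + (B.1 f).1 y = 0
    rw [hA f y hy, hB f y hy, add_zero]
  zero_mem' _ _ _ := rfl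
  smul_mem' c A hA f y hy := by
    change c * (A.1 f).1 y = 0
    rw [hA f y hy, mul_zero]

theorem mul_mem_vanishOn_left [IsManifold 𝓘(ℂ, Cn d) ω M] (hW : IsOpen W) (A : diffOps d M)
    {B : diffOps d M} (hB : B ∈ vanishOn d M W) : A * B ∈ vanishOn d M W := by
  intro f y hy
  have h1 : (B.1 f).1 =ᶠ[nhds y] (0 : Smooth d M).1 := by
    filter_upwards [hW.mem_nhds hy] with z hz
    exact hB f z hz
  have h2 := IsDiffOp.apply_eq_of_eventuallyEq A.2 h1
  rw [map_zero] at h2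
  exact h2

theorem mul_mem_vanishOn_right (A : diffOps d M) {B : diffOps d M} (hB : B ∈ vanishOn d M W) :
    B * A ∈ vanishOn d M W :=
  fun f y hy => hB (A.1 f) y hy

/-- The value `(A f)(y)` as a linear function of the differential operator `A`. -/
def evalAt (f : Smooth d M) (y : M) : diffOps d M →ₗ[ℂ] ℂ where
  toFun A := (A.1 f).1 y
  map_add' _ _ := rfl
  map_smul' _ _ := rfl

/-- Multiplication operators, as elements of the algebra of differential operators. -/
def mulDiffOp (a : Smooth d M) : diffOps d M := ⟨mulOp a, mulOp_mem_diffOps a⟩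

/-- The multiplications with members of a family of functions. -/
def mulFamily {κ : Type*} (c : κ → Smooth d M) : Set (diffOps d M) :=
  Set.range fun i => mulDiffOp (c i)

theorem mulDiffOp_comm (a b : Smooth d M) : mulDiffOp a * mulDiffOp b = mulDiffOp b * mulDiffOp a :=
  Subtype.ext (by
    change mulOp a * mulOp b = mulOp b * mulOp a
    rw [← map_mul, mul_comm, map_mul])

variable [T2Space M] [IsManifold 𝓘(ℂ, Cn d) ω M] {e : OpenPartialHomeomorph M (Cn d)} {y : M}

/-- Membership in step `n` of the commutator filtration bounds the degree of the symbol. -/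
theorem coeff_eq_zero_of_mem_commFilt (he : e ∈ holCharts d M) (hWe : W ⊆ e.source)
    {c : Dir d → Smooth d M} (hc : ∀ y ∈ W, ∀ i, Rep e y (coord i) (c i).1)
    {S : Set (diffOps d M)} (hS : ∀ i, mulDiffOp (c i) ∈ S) {n : ℕ} {A : diffOps d M}
    (hA : A ∈ commFilt (vanishOn d M W) S n) (hy : y ∈ W) {P : MvPolynomial (Dir d) ℂ}
    (hP : HasSymbol e y A.1 P) {m : Dir d →₀ ℕ} (hm : n ≤ m.degree) : P.coeff m = 0 := by
  classical
  induction n generalizing A P m with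
  | zero =>
    have h0 : HasSymbol e y A.1 0 := fun f F _ => by
      rw [map_zero]
      exact hA f y hy
    rw [hP.unique he (hWe hy) h0, MvPolynomial.coeff_zero]
  | succ n ih =>
    have hm0 : m ≠ 0 := by
      rintro rfl
      simp at hm
    obtain ⟨i, hi⟩ := Finsupp.ne_iff.1 hm0
    obtain ⟨m', rfl⟩ : ∃ m', m = m' + Finsupp.single i 1 :=
      ⟨m - Finsupp.single i 1, (tsub_add_cancel_of_le (Finsupp.single_le_iff.2
        (Nat.one_le_iff_ne_zero.2 hi))).symm⟩
    have hdeg : n ≤ m'.degree := by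
      rw [map_add, Finsupp.degree_single] at hm
      omega
    have h1 := ih (hA _ (hS i)) (hP.commutator_coord (hc y hy i)) hdeg
    rw [MvPolynomial.coeff_pderiv] at h1
    rcases mul_eq_zero.1 h1 with h2 | h2
    · exact h2
    · exact absurd h2 (Nat.cast_add_one_ne_zero (m' i))

/-- The operators commuting with the coordinate functions over `W` are multiplications over `W`. -/
theorem exists_scalar_of_mem_commFilt_one (he : e ∈ holCharts d M) (hWe : W ⊆ e.source)
    {c : Dir d → Smooth d M} (hc : ∀ y ∈ W, ∀ i, Rep e y (coord i) (c i).1)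
    {S : Set (diffOps d M)} (hS : ∀ i, mulDiffOp (c i) ∈ S) {A : diffOps d M}
    (hA : A ∈ commFilt (vanishOn d M W) S 1) (hy : y ∈ W) :
    ∃ t : ℂ, ∀ f : Smooth d M, (A.1 f).1 y = t * f.1 y := by
  obtain ⟨P, hP⟩ := IsDiffOp.exists_hasSymbol A.2 he (hWe hy)
  have h1 : P = MvPolynomial.C (P.coeff 0) := by
    classical
    ext m
    rw [MvPolynomial.coeff_C]
    split_ifs with h
    · rw [h]
    · refine coeff_eq_zero_of_mem_commFilt he hWe hc hS hA hy hP (Nat.one_le_iff_ne_zero.2 ?_)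
      rw [Ne, Finsupp.degree_eq_zero_iff]
      exact fun h' => h h'.symm
  refine ⟨P.coeff 0, fun f => ?_⟩
  obtain ⟨F, hF⟩ := exists_rep_smooth he (hWe hy) f
  rw [hP f F hF, h1, MvPolynomial.coeff_C, if_pos rfl, ← MvPolynomial.algebraMap_eq,
    AlgHom.commutes, hF.self_eq]
  rfl

theorem commutator_mem_vanishOn (he : e ∈ holCharts d M) (hWe : W ⊆ e.source)
    {c : Dir d → Smooth d M} (hc : ∀ y ∈ W, ∀ i, Rep e y (coord i) (c i).1)
    {S : Set (diffOps d M)} (hS : ∀ i, mulDiffOp (c i) ∈ S) {A B : diffOps d M}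
    (hA : A ∈ commFilt (vanishOn d M W) S 1) (hB : B ∈ commFilt (vanishOn d M W) S 1) :
    A * B - B * A ∈ vanishOn d M W := by
  intro f y hy
  obtain ⟨s, hs⟩ := exists_scalar_of_mem_commFilt_one he hWe hc hS hA hy
  obtain ⟨t, ht⟩ := exists_scalar_of_mem_commFilt_one he hWe hc hS hB hy
  change (A.1 (B.1 f)).1 y - (B.1 (A.1 f)).1 y = 0
  rw [hs, ht, ht, hs]
  ring

end LocalFiltration

/-! ### Conjugation by the Berezin transform -/

section Conjugation

variable {d : ℕ} {M : Type*} [TopologicalSpace M] [ChartedSpace (Cn d) M]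
  {P : Structure d M} {S : StarProduct P}

theorem StarProduct.IsBerezin.coeff_mul_eventuallyEq {B : PowerSeries (Op d M)}
    (hB : S.IsBerezin B) {y : M} {a b : Smooth d M} (ha : HolNear d y a.1)
    (hb : AntiholNear d y b.1) (r : ℕ) :
    (PowerSeries.coeff r B (a * b)).1 =ᶠ[nhds y] (S.C r b a).1 := by
  filter_upwards [ha.eventually, HolNear.eventually hb] with z hza hzb
  exact (isBerezin_iff.1 hB).2 r z a b hza hzb

theorem isDiffOp_sum {κ : Type*} (T : Finset κ) {A : κ → Op d M} (hA : ∀ p, IsDiffOp (A p)) :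
    IsDiffOp (∑ p ∈ T, A p) :=
  Subalgebra.sum_mem (diffOps d M) fun p _ => hA p

theorem sum_op_apply {κ : Type*} (T : Finset κ) (A : κ → Op d M) (f : Smooth d M) (y : M) :
    ((∑ p ∈ T, A p) f).1 y = ∑ p ∈ T, (A p f).1 y := by
  rw [LinearMap.sum_apply, sum_apply_smooth]

variable [T2Space M] [IsManifold 𝓘(ℂ, Cn d) ω M]

/-- `B(a f) = B(f) * a` wherever `a` is holomorphic. It suffices to take `f = uv` with `u`
holomorphic and `v` antiholomorphic, where both sides are `v * u * a`. -/
theorem StarProduct.IsBerezin.coeff_hol_mul (hS : S.HasSeparation) {B : PowerSeries (Op d M)}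
    (hB : S.IsBerezin B) {y : M} {a : Smooth d M} (ha : HolNear d y a.1) (n : ℕ)
    (f : Smooth d M) : (PowerSeries.coeff n B (a * f)).1 y =
      ∑ p ∈ Finset.HasAntidiagonal.antidiagonal n,
        (S.C p.1 (PowerSeries.coeff p.2 B f) a).1 y := by
  have h1 : IsDiffOp (PowerSeries.coeff n B * mulOp a) :=
    (diffOps d M).mul_mem (hB.1 n) (mulOp_mem_diffOps a)
  have h2 : IsDiffOp (∑ p ∈ Finset.HasAntidiagonal.antidiagonal n,
      (S.C p.1).flip a * PowerSeries.coeff p.2 B) :=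
    isDiffOp_sum _ fun p => (diffOps d M).mul_mem ((hS p.1).isDiffOp_right a) (hB.1 p.2)
  have h3 := h1.apply_eq_of_eq_on_products h2 y ?_ f
  · rw [sum_op_apply] at h3
    exact h3
  intro u v hu hv
  rw [sum_op_apply]
  change (PowerSeries.coeff n B (a * (u * v))).1 y = ∑ p ∈ Finset.HasAntidiagonal.antidiagonal n,
    ((S.C p.1).flip a (PowerSeries.coeff p.2 B (u * v))).1 y
  have h4 : ∀ p : ℕ × ℕ, ((S.C p.1).flip a (PowerSeries.coeff p.2 B (u * v))).1 y =
      (S.C p.1 (S.C p.2 v u) a).1 y := fun p =>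
    ((hS p.1).isDiffOp_right a).apply_eq_of_eventuallyEq (hB.coeff_mul_eventuallyEq hu hv p.2)
  rw [← _root_.mul_assoc, (hB.coeff_mul_eventuallyEq (ha.mul hu : HolNear d y (a * u).1) hv n).eq_of_nhds,
    Finset.sum_congr rfl fun p _ => h4 p, ← sum_apply_smooth, S.sum_assoc, sum_apply_smooth,
    Finset.sum_eq_single (n, 0)]
  · rw [S.C_zero, mul_comm]
  · intro p hp hne
    have hp' := Finset.HasAntidiagonal.mem_antidiagonal.1 hp
    have hp2 : p.2 ≠ 0 := fun h0 => hne (Prod.ext (by simp; omega) h0)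
    have h5 : (S.C p.2 u a).1 =ᶠ[nhds y] (0 : Smooth d M).1 := by
      filter_upwards [hu.eventually] with z hz
      exact hS.C_of_hol_left hz a hp2
    rw [((hS p.1).isDiffOp_left v).apply_eq_of_eventuallyEq h5, map_zero]
    rfl
  · intro h
    exact absurd (Finset.HasAntidiagonal.mem_antidiagonal.2 (by simp)) h

/-- `B(b f) = b * B(f)` wherever `b` is antiholomorphic. It suffices to take `f = uv` with `u`
holomorphic and `v` antiholomorphic, where both sides are `b * v * u`. -/
theorem StarProduct.IsBerezin.coeff_antihol_mul (hS : S.HasSeparation)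
    {B : PowerSeries (Op d M)} (hB : S.IsBerezin B) {y : M} {b : Smooth d M}
    (hb : AntiholNear d y b.1) (n : ℕ) (f : Smooth d M) :
    (PowerSeries.coeff n B (b * f)).1 y =
      ∑ p ∈ Finset.HasAntidiagonal.antidiagonal n,
        (S.C p.1 b (PowerSeries.coeff p.2 B f)).1 y := by
  have h1 : IsDiffOp (PowerSeries.coeff n B * mulOp b) :=
    (diffOps d M).mul_mem (hB.1 n) (mulOp_mem_diffOps b)
  have h2 : IsDiffOp (∑ p ∈ Finset.HasAntidiagonal.antidiagonal n,
      (S.C p.1 b * PowerSeries.coeff p.2 B : Op d M)) :=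
    isDiffOp_sum _ fun p => (diffOps d M).mul_mem ((hS p.1).isDiffOp_left b) (hB.1 p.2)
  have h3 := h1.apply_eq_of_eq_on_products h2 y ?_ f
  · rw [sum_op_apply] at h3
    exact h3
  intro u v hu hv
  rw [sum_op_apply]
  change (PowerSeries.coeff n B (b * (u * v))).1 y = ∑ p ∈ Finset.HasAntidiagonal.antidiagonal n,
    (S.C p.1 b (PowerSeries.coeff p.2 B (u * v))).1 y
  have h4 : ∀ p : ℕ × ℕ, (S.C p.1 b (PowerSeries.coeff p.2 B (u * v))).1 y =
      (S.C p.1 b (S.C p.2 v u)).1 y := fun p =>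
    ((hS p.1).isDiffOp_left b).apply_eq_of_eventuallyEq (hB.coeff_mul_eventuallyEq hu hv p.2)
  rw [mul_left_comm, (hB.coeff_mul_eventuallyEq hu (hb.mul hv : AntiholNear d y (b * v).1) n).eq_of_nhds,
    Finset.sum_congr rfl fun p _ => h4 p, ← sum_apply_smooth, ← S.sum_assoc, sum_apply_smooth,
    Finset.sum_eq_single (n, 0)]
  · rw [S.C_zero]
  · intro p hp hne
    have hp' := Finset.HasAntidiagonal.mem_antidiagonal.1 hp
    have hp2 : p.2 ≠ 0 := fun h0 => hne (Prod.ext (by simp; omega) h0)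
    have h5 : (S.C p.2 b v).1 =ᶠ[nhds y] (0 : Smooth d M).1 := by
      filter_upwards [HolNear.eventually hv] with z hz
      exact hS.C_of_antihol_right hz b hp2
    have h6 := ((hS p.1).isDiffOp_right u).apply_eq_of_eventuallyEq h5
    rw [map_zero] at h6
    exact h6
  · intro h
    exact absurd (Finset.HasAntidiagonal.mem_antidiagonal.2 (by simp)) h

theorem StarProduct.IsBerezin.coeff_zero {B : PowerSeries (Op d M)} (hB : S.IsBerezin B) :
    PowerSeries.coeff 0 B = 1 := by
  ext f y
  refine (hB.1 0).apply_eq_of_eq_on_products (diffOps d M).one_mem y (fun a b ha hb => ?_) f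
  rw [(hB.coeff_mul_eventuallyEq ha hb 0).eq_of_nhds, S.C_zero, mul_comm]
  rfl

end Conjugation

/-! ### Naturality of the logarithm -/

section Naturality

variable {d : ℕ} {M : Type*} [TopologicalSpace M] [ChartedSpace (Cn d) M]
  {P : Structure d M} {S : StarProduct P}

theorem isDiffOpOfOrderLE_zero (r : ℕ) : IsDiffOpOfOrderLE r (0 : Op d M) := fun e _ x hx =>
  ⟨e.source, subset_rfl, e.open_source, hx, ∅, 0, by simp, by simp, fun f y _ => by simp⟩

/-- `ν Y`, for a series `Y` of differential operators. -/
def nuMul (Y : PowerSeries (diffOps d M)) : PowerSeries (Op d M) :=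
  PowerSeries.X * PowerSeries.map (diffOps d M).val.toRingHom Y

theorem divNu_nuMul (Y : PowerSeries (diffOps d M)) :
    divNu (nuMul Y) = PowerSeries.map (diffOps d M).val.toRingHom Y := by
  ext1 n
  rw [divNu, PowerSeries.coeff_mk, nuMul, PowerSeries.coeff_succ_X_mul]

theorem formalExp_map (Y : PowerSeries (diffOps d M)) (n : ℕ) :
    PowerSeries.coeff n (formalExp (PowerSeries.map (diffOps d M).val.toRingHom Y)) =
      (expCoeff Y n).1 := by
  rw [formalExp, PowerSeries.coeff_mk, expCoeff, AddSubmonoidClass.coe_finsetSum]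
  refine Finset.sum_congr rfl fun k _ => ?_
  rw [← map_pow, PowerSeries.coeff_map]
  rfl

variable [T2Space M] [IsManifold 𝓘(ℂ, Cn d) ω M]

theorem differentiable_coord_inl (k : Fin d) : Differentiable ℂ (coord (.inl k)).1 := by
  have h : (coord (.inl k)).1 = fun z : Cn d => z k := rfl
  rw [h]
  fun_prop

theorem differentiable_conj_coord_inr (k : Fin d) :
    Differentiable ℂ fun z => (starRingEnd ℂ) ((coord (.inr k)).1 z) := by
  have h : (fun z => (starRingEnd ℂ) ((coord (.inr k)).1 z)) = fun z : Cn d => z k := by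
    funext z
    exact Complex.conj_conj _
  rw [h]
  fun_prop

/-- The coefficient `Y_r` of the logarithm `Y` of the Berezin transform is of order at most
`r + 1`. The order estimate is applied with the classes of the holomorphic and of the
antiholomorphic coordinates of a chart, modulo the operators that vanish near a point: `B`
intertwines `a` with the right multiplication `f ↦ f * a`, which commutes with holomorphic
functions, and `b` with the left multiplication by `b`, which commutes with antiholomorphic
functions. -/
theorem StarProduct.IsBerezin.log_orderLE (hS : S.HasSeparation) {B : PowerSeries (Op d M)}
    (hB : S.IsBerezin B) {Y : PowerSeries (diffOps d M)} (h0 : PowerSeries.coeff 0 Y = 0)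
    (hY : ∀ n, (expCoeff Y n).1 = PowerSeries.coeff n B) (r : ℕ) :
    IsDiffOpOfOrderLE (r + 1) (PowerSeries.coeff r Y).1 := by
  intro e he x hx
  choose c hcx using fun i : Dir d => exists_smooth_rep he hx (coord i)
  obtain ⟨W, hWp, hW, hxW⟩ := eventually_nhds_iff.1
    ((Filter.eventually_all.2 fun i => (hcx i).eventually).and (e.open_source.mem_nhds hx))
  have hc : ∀ y ∈ W, ∀ i, Rep e y (coord i) (c i).1 := fun y hy => (hWp y hy).1
  have hWe : W ⊆ e.source := fun y hy => (hWp y hy).2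
  have hhol : ∀ y ∈ W, ∀ k, HolNear d y (c (.inl k)).1 := fun y hy k =>
    holNear_of_rep he (hWe hy) (differentiable_coord_inl k) (hc y hy _)
  have hanti : ∀ y ∈ W, ∀ k, AntiholNear d y (c (.inr k)).1 := fun y hy k =>
    antiholNear_of_rep he (hWe hy) (differentiable_conj_coord_inr k) (hc y hy _)
  let S₁ : Set (diffOps d M) := mulFamily fun k => c (.inl k)
  let S₂ : Set (diffOps d M) := mulFamily fun k => c (.inr k)
  have hSc : ∀ i, mulDiffOp (c i) ∈ S₁ ∪ S₂ := by
    rintro (k | k)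
    · exact Or.inl ⟨k, rfl⟩
    · exact Or.inr ⟨k, rfl⟩
  have hSS : ∀ s ∈ S₁ ∪ S₂, ∀ t ∈ S₁ ∪ S₂, s * t = t * s := by
    rintro _ (⟨k, rfl⟩ | ⟨k, rfl⟩) _ (⟨l, rfl⟩ | ⟨l, rfl⟩) <;> exact mulDiffOp_comm _ _
  have hcoef : ∀ (a : diffOps d M) (Q : PowerSeries (diffOps d M)) (n : ℕ) (f : Smooth d M) (y : M),
      ((PowerSeries.coeff n (PowerSeries.mk (expCoeff Y) * PowerSeries.C a -
        Q * PowerSeries.mk (expCoeff Y))).1 f).1 y =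
      (PowerSeries.coeff n B (a.1 f)).1 y - ∑ p ∈ Finset.HasAntidiagonal.antidiagonal n,
        ((PowerSeries.coeff p.1 Q).1 (PowerSeries.coeff p.2 B f)).1 y := by
    intro a Q n f y
    rw [map_sub, PowerSeries.coeff_mul_C, PowerSeries.coeff_mk, PowerSeries.coeff_mul]
    simp only [PowerSeries.coeff_mk, ← hY]
    change evalAt f y (_ - _) = _
    rw [map_sub, map_sum]
    rfl
  have hmem := log_mem_commFilt (N := vanishOn d M W) (fun A B hB => mul_mem_vanishOn_left hW A hB)
    (fun A B hB => mul_mem_vanishOn_right A hB) hSS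
    (fun A hA B hB => commutator_mem_vanishOn he hWe hc hSc hA hB) h0 ?_ r
  · exact exists_local_form_of_degree_le (PowerSeries.coeff r Y).2 he hW hx hxW
      fun y hy P hP m hm => coeff_eq_zero_of_mem_commFilt he hWe hc hSc hmem hy hP hm
  rintro T (rfl | rfl)
  -- `Q` is the right multiplication by `z^k`
  · rintro _ ⟨k, rfl⟩
    refine ⟨PowerSeries.mk fun n => ⟨(S.C n).flip (c (.inl k)), (hS n).isDiffOp_right _⟩, ?_, ?_⟩
    · intro n f y hy
      rw [hcoef, sub_eq_zero]
      simp only [PowerSeries.coeff_mk]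
      exact hB.coeff_hol_mul hS (hhol y hy k) n f
    · rintro n _ ⟨l, rfl⟩ f y hy
      rw [PowerSeries.coeff_mk]
      exact sub_eq_zero.2 ((hS n).hol_mul_left (hhol y hy l) f _)
  -- `Q` is the left multiplication by `z̄^k`
  · rintro _ ⟨k, rfl⟩
    refine ⟨PowerSeries.mk fun n => ⟨S.C n (c (.inr k)), (hS n).isDiffOp_left _⟩, ?_, ?_⟩
    · intro n f y hy
      rw [hcoef, sub_eq_zero]
      simp only [PowerSeries.coeff_mk]
      exact hB.coeff_antihol_mul hS (hanti y hy k) n f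
    · rintro n _ ⟨l, rfl⟩ f y hy
      rw [PowerSeries.coeff_mk]
      exact sub_eq_zero.2 ((hS n).antihol_mul_right (hanti y hy l) _ f)

/-! ### The first coefficient -/

theorem D_D_mul_of_hol_of_antihol {F G : Smooth d (Cn d)} {z : Cn d}
    (hF : ∀ k, (D (.inr k) F).1 =ᶠ[nhds z] 0) (hG : ∀ k, (D (.inl k) G).1 =ᶠ[nhds z] 0)
    (k l : Fin d) : (D (.inl k) (D (.inr l) (F * G))).1 z =
      (D (.inl k) F).1 z * (D (.inr l) G).1 z := by
  have h1 : (D (.inr l) (F * G)).1 =ᶠ[nhds z] (F * D (.inr l) G).1 := by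
    rw [D_mul]
    filter_upwards [hF l] with w hw
    change (D (.inr l) F).1 w * G.1 w + F.1 w * (D (.inr l) G).1 w = F.1 w * (D (.inr l) G).1 w
    rw [hw]
    simp
  have h2 : (D (.inl k) (D (.inr l) G)).1 z = 0 := by
    have h3 : D (.inl k) (D (.inr l) G) = D (.inr l) (D (.inl k) G) :=
      LinearMap.congr_fun (D_comm (.inl k) (.inr l)) G
    have h4 : (D (.inl k) G).1 =ᶠ[nhds z] (0 : Smooth d (Cn d)).1 := hG k
    have h5 := rawD_congr h4 (.inr l)
    rw [← D_apply, ← D_apply, map_zero] at h5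
    rw [h3, h5]
    rfl
  rw [D_apply, rawD_congr h1, ← D_apply, D_mul]
  change (D (.inl k) F).1 z * (D (.inr l) G).1 z + F.1 z * (D (.inl k) (D (.inr l) G)).1 z = _
  rw [h2, mul_zero, add_zero]

/-- The first coefficient of the Berezin transform is the operator `Δ`: as `C_1(a, b) = 0` for `a`
holomorphic, `B_1(ab) = C_1(b, a) = {b, a}`, and only one half of the bracket survives. -/
theorem StarProduct.IsBerezin.isDelta_coeff_one (hS : S.HasSeparation)
    {B : PowerSeries (Op d M)} (hB : S.IsBerezin B) : P.IsDelta (PowerSeries.coeff 1 B) := by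
  rintro e he g ⟨-, hg⟩ f x hx
  obtain ⟨Q, hQ⟩ := (hB.1 1).exists_hasSymbol he hx
  let Q' : MvPolynomial (Dir d) ℂ := ∑ l : Fin d, ∑ k : Fin d,
    g l k x • (MvPolynomial.X (.inl k) * MvPolynomial.X (.inr l))
  have hQ' : ∀ F : Smooth d (Cn d), (symb Q' F).1 (e x) =
      ∑ l, ∑ k, g l k x * (D (.inl k) (D (.inr l) F)).1 (e x) := by
    intro F
    simp only [Q', map_sum, LinearMap.sum_apply, sum_apply_smooth, map_smul, symb_X_mul, symb_X]
    rfl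
  have hQQ : Q = Q' := symb_eq_of_eq_on_products he hx fun a b F G ha hb hF hG => by
    have hF0 := ha.D_inr_eq_zero he hx hF
    have hG0 := hb.D_inl_eq_zero he hx hG
    have hraw : ∀ {h : Smooth d M} {H : Smooth d (Cn d)}, Rep e x H h.1 → ∀ i,
        rawD i (h.1 ∘ e.symm) (e x) = (D i H).1 (e x) := fun hH i =>
      rawD_congr (hH.eventuallyEq_symm hx).symm i
    have h1 := congrArg (fun h : Smooth d M => h.1 x) (S.C_one b a)
    simp only [hg _ _ x hx] at h1
    have h2 : (S.C 1 b a - S.C 1 a b).1 x = (S.C 1 b a).1 x - (S.C 1 a b).1 x := rfl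
    rw [h2, hS.C_of_hol_left ha b one_ne_zero, sub_zero] at h1
    rw [← hQ (a * b) (F * G) (hF.mul hG), (hB.coeff_mul_eventuallyEq ha hb 1).eq_of_nhds, h1, hQ']
    refine Finset.sum_congr rfl fun l _ => Finset.sum_congr rfl fun k _ => ?_
    rw [D_D_mul_of_hol_of_antihol hF0 hG0]
    have e1 := hraw hG (.inr l)
    have e2 := hraw hF (.inl k)
    have e3 := hraw hF (.inr l)
    rw [(hF0 l).eq_of_nhds] at e3
    simp only [rawD] at e1 e2 e3
    rw [e1, e2, e3]
    simp [mul_comm]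
  obtain ⟨F, hF⟩ := exists_rep_smooth he hx f
  rw [hQ f F hF, hQQ, hQ']
  refine Finset.sum_congr rfl fun l _ => Finset.sum_congr rfl fun k _ => ?_
  congr 1
  exact rawD_congr (rawD_congr_eventually (hF.eventuallyEq_symm hx) (.inr l)) (.inl k)

end Naturality

end KahlerPoisson

end

theorem mainTheorem5 (d : ℕ) (M : Type*) [TopologicalSpace M] [T2Space M]
    [ChartedSpace (KahlerPoisson.Cn d) M] [IsManifold 𝓘(ℂ, KahlerPoisson.Cn d) ω M]
    (P : KahlerPoisson.Structure d M) (S : KahlerPoisson.StarProduct P) (hS : S.HasSeparation) :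
    (∃! B : PowerSeries (KahlerPoisson.Op d M), S.IsBerezin B) ∧
    ∀ B : PowerSeries (KahlerPoisson.Op d M), S.IsBerezin B →
      ∃ X : PowerSeries (KahlerPoisson.Op d M),
        KahlerPoisson.IsNatural X ∧
        PowerSeries.coeff 0 X = 0 ∧ PowerSeries.coeff 1 X = 0 ∧
        P.IsDelta (PowerSeries.coeff 2 X) ∧
        B = KahlerPoisson.formalExp (KahlerPoisson.divNu X) := by
  refine ⟨hS.existsUnique_isBerezin, fun B hB => ?_⟩
  -- `B = exp Y` with a series `Y` of differential operators, and `X = ν Y`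
  obtain ⟨Y, hY0, hY⟩ := KahlerPoisson.exists_log
    (B := PowerSeries.mk fun n =>
      (⟨PowerSeries.coeff n B, hB.1 n⟩ : KahlerPoisson.diffOps d M))
    (by rw [PowerSeries.coeff_mk]; exact Subtype.ext hB.coeff_zero)
  have hexp : ∀ n, (KahlerPoisson.expCoeff Y n).1 = PowerSeries.coeff n B := fun n => by
    rw [← hY n, PowerSeries.coeff_mk]
  have hX : ∀ n, PowerSeries.coeff (n + 1) (KahlerPoisson.nuMul Y) = (PowerSeries.coeff n Y).1 :=
    fun n => by rw [KahlerPoisson.nuMul, PowerSeries.coeff_succ_X_mul, PowerSeries.coeff_map]; rfl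
  have hX0 : PowerSeries.coeff 0 (KahlerPoisson.nuMul Y) = 0 := by
    rw [KahlerPoisson.nuMul, PowerSeries.coeff_zero_X_mul]
  refine ⟨KahlerPoisson.nuMul Y, ?_, hX0, ?_, ?_, ?_⟩
  · rintro (_ | r)
    · rw [hX0]
      exact KahlerPoisson.isDiffOpOfOrderLE_zero 0
    · rw [hX]
      exact hB.log_orderLE hS hY0 hexp r
  · rw [hX 0, hY0]
    rfl
  · have h1 := hexp 1
    rw [KahlerPoisson.expCoeff_one] at h1
    rw [hX 1, h1]
    exact hB.isDelta_coeff_one hS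
  · ext1 n
    rw [KahlerPoisson.divNu_nuMul, KahlerPoisson.formalExp_map, hexp]
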